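/- Fix $d\in\mathbb N$, $m=(m_1,\dots,m_d)\in\mathbb N^d$, a field $k$, and an infinite extension field $K$ of $k$ (for example $K=k$ if $k$ is infinite, or $K=\bar k$ for arbitrary $k$). Affine spaces $K^\sigma$ carry the Zariski topology over $k$: closed sets are the sets of common zeros in $K^\sigma$ of polynomials with coefficients in $k$. **The grid.** Let $I=[1,m_1]\times\dots\times[1,m_d]$, and let $E\subset I\times I$ be the set of arrows $(i,j):i\to j$ such that $j$ is obtained from $i$ by raising exactly one coordinate by $1$. Let $A$ be the generalized Cartan matrix with $A_{ii}=2$ and $A_{ij}=-\#\{\text{arrows } i\to j\}-\#\{\text{arrows } j\to i\}$ for $i\ne j$. Let $(\mathfrak h,\{\alpha_i\},\{h_i\})$ be any realization of $A$: a complex vector space of dimension $2|I|-\operatorname{rank}A$ with linearly independent $\alpha_i\in\mathfrak h^*$ and linearly independent $h_i\in\mathfrak h$, $\langle h_i,\alpha_j\rangle=A_{ij}$. Let $P\subset\mathfrak h^*$ be any weight lattice: a free abelian subgroup containing all $\alpha_i$, with $\mathbb C\otimes_{\mathbb Z}P\cong\mathfrak h^*$ naturally and $\langle h_i,P\rangle\subset\mathbb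 Z$ for all $i$. **Components.** For $\nu=-\sum_i\nu_i\alpha_i$ with $\nu_i\in\mathbb N$, let $E_C(\nu)$ be the set of families $f=(f_\tau)_{\tau\in E}$ of linear maps $f_\tau:K^{\nu_{s(\tau)}}\to K^{\nu_{t(\tau)}}$ ($s,t$ denoting source and target) whose compositions along any two parallel paths agree, with the topology induced from the affine space of matrix entries. Let $B_C(\nu)$ be the set of irreducible components of $E_C(\nu)$ and $B_C=\bigsqcup_\nu B_C(\nu)$. For $\Lambda\in B_C(\nu)$ put $\mathrm{wt}(\Lambda)=\nu$, $$\varepsilon_i^*(f)=\dim\ker\Big((f_\tau)_{s(\tau)=i}:K^{\nu_i}\to\bigoplus_{s(\tau)=i}K^{\nu_{t(\tau)}}\Big),\quad \varepsilon_i^*(\Lambda)=\min_{f\in\Lambda}\varepsilon_i^*(f),\quad \varphi_i^*(\Lambda)=\varepsilon_i^*(\Lambda)+\langle h_i,\mathrm{wt}(\Lambda)\rangle .$$ **Operators.** For $i\in I$ and $\nu+\alpha_i\in-\sum_j\mathbb N\alpha_j$, let $E'_C(-\alpha_i,\nu+\alpha_i)$ be the set of triples $((\bar\phi_j)_{j\in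 I},(\phi'_j)_{j\in I},f)$ with $f\in E_C(\nu)$ and short exact sequences $0\to K^{\delta_{ij}}\xrightarrow{\bar\phi_j}K^{\nu_j}\xrightarrow{\phi'_j}K^{\nu_j-\delta_{ij}}\to0$ such that $f_\tau(\operatorname{im}\bar\phi_{s(\tau)})\subset\operatorname{im}\bar\phi_{t(\tau)}$ for all $\tau$. Let $\varpi_4$ send such a triple to $f\in E_C(\nu)$, and let $\varpi_3$ send it to the quotient representation $f'\in E_C(\nu+\alpha_i)$, determined by $f'_\tau\phi'_{s(\tau)}=\phi'_{t(\tau)}f_\tau$. Let $\mathrm{in}_1(i)=\{j:(j,i)\in E\}$, and let $\mathrm{in}_2(i)$ be the set of $l\in I$ that have arrows to two distinct elements of $\mathrm{in}_1(i)$. For $f\in E_C(\nu)$ let $F_i(f):\bigoplus_{j\in\mathrm{in}_1(i)}K^{\nu_j}\to\bigoplus_{l\in\mathrm{in}_2(i)}K^{\nu_l}$ have the component $f_{(l,j)}^{T}$ (respectively $-f_{(l,j)}^{T}$) from $j$ to $l$ if $l$ has arrows to $j$ and to some $j'\in\mathrm{in}_1(i)$ with $j<j'$ (respectively $j'<j$)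 lexicographically, and $0$ otherwise. Put $\widetilde{\mathrm{Ext}}{}^*_i(f)=(\ker F_i(f))^*$. For $\Lambda'\in B_C(\nu+\alpha_i)$ let $\Lambda'^{3}\subset\Lambda'$ be the locus where $\dim\widetilde{\mathrm{Ext}}{}^*_i$ attains its minimum on $\Lambda'$. For $\Lambda\in B_C(\nu)$ let $\Lambda^4\subset\Lambda$ be the locus where $\varepsilon_i^*$ attains its minimum on $\Lambda$. Define $$\tilde f_i^*\Lambda'=\begin{cases}\overline{\varpi_4\varpi_3^{-1}(\Lambda'^{3})}&\text{if this set lies in }B_C(\nu),\\0&\text{otherwise,}\end{cases}$$ $$\tilde e_i^*\Lambda=\begin{cases}\overline{\varpi_3\varpi_4^{-1}(\Lambda^{4})}&\text{if }\varepsilon_i^*(\Lambda)>0\text{ and this set lies in }B_C(\nu+\alpha_i),\\0&\text{otherwise.}\end{cases}$$ **Theorem.** The tuple $(B_C,\mathrm{wt},(\varepsilon_i^*)_{i\in I},(\varphi_i^*)_{i\in I},(\tilde e_i^*)_{i\in I},(\tilde f_i^*)_{i\in I})$ is a (Kashiwara) crystal for $A$ and $P$. That is, $A$ is a generalized Cartan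 matrix, $\mathrm{wt}$ takes values in $P$, $\varepsilon_i^*$ and $\varphi_i^*$ take values in $\mathbb Z\sqcup\{-\infty\}$, $\tilde e_i^*$ and $\tilde f_i^*$ take values in $B_C\sqcup\{0\}$, and for all $i\in I$ and $b,b'\in B_C$: 1. $\varphi_i^*(b)=\varepsilon_i^*(b)+\langle h_i,\mathrm{wt}(b)\rangle$; 2. if $\tilde e_i^*b\ne0$, then $\mathrm{wt}(\tilde e_i^*b)=\mathrm{wt}(b)+\alpha_i$, $\varepsilon_i^*(\tilde e_i^*b)=\varepsilon_i^*(b)-1$ and $\varphi_i^*(\tilde e_i^*b)=\varphi_i^*(b)+1$; 3. if $\tilde f_i^*b\ne0$, then $\mathrm{wt}(\tilde f_i^*b)=\mathrm{wt}(b)-\alpha_i$, $\varepsilon_i^*(\tilde f_i^*b)=\varepsilon_i^*(b)+1$ and $\varphi_i^*(\tilde f_i^*b)=\varphi_i^*(b)-1$; 4. $b=\tilde e_i^*b'$ if and only if $\tilde f_i^*b=b'$; 5. if $\varphi_i^*(b)=-\infty$, then $\tilde e_i^*b=\tilde f_i^*b=0$. -/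

import Mathlib

/-! # The star-crystal of irreducible components of varieties of persistence modules -/

noncomputable section

namespace PersistenceCrystal

/-! ## Kashiwara crystals -/

section Crystals

variable {I : Type*} [Fintype I]

/-- Generalized Cartan matrices. -/
structure IsGCM (A : Matrix I I ℤ) : Prop where
  diag : ∀ i, A i i = 2
  nonpos : ∀ i j, i ≠ j → A i j ≤ 0
  symm_ne_zero : ∀ i j, i ≠ j → A i j ≠ 0 → A j i ≠ 0

/-- A realization `(𝔥, Π, Π^∨)` of a square integral matrix `A`: linearly independent simple
roots `α_i ∈ 𝔥*` and simple coroots `h_i ∈ 𝔥` with `⟨h_i, α_j⟩ = A i j`, where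
`dim 𝔥 = 2 |I| - rank A`. -/
structure Realization (A : Matrix I I ℤ) (𝔥 : Type*) [AddCommGroup 𝔥] [Module ℂ 𝔥] where
  root : I → Module.Dual ℂ 𝔥
  coroot : I → 𝔥
  root_linearIndependent : LinearIndependent ℂ root
  coroot_linearIndependent : LinearIndependent ℂ coroot
  root_coroot : ∀ i j, root j (coroot i) = (A i j : ℂ)
  finiteDimensional : FiniteDimensional ℂ 𝔥
  finrank_add_rank :
    Module.finrank ℂ 𝔥 + (A.map (Int.cast : ℤ → ℂ)).rank = 2 * Fintype.card I

variable {A : Matrix I I ℤ} {𝔥 : Type*} [AddCommGroup 𝔥] [Module ℂ 𝔥]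

/-- A weight lattice for a realization: a free abelian subgroup `P ⊂ 𝔥*` with
`ℂ ⊗_ℤ P ≅ 𝔥*` (through the natural map), with `⟨h_i, λ⟩ ∈ ℤ` for `λ ∈ P`, and with
`α_i ∈ P`. -/
structure WeightLattice (R : Realization A 𝔥) where
  P : Submodule ℤ (Module.Dual ℂ 𝔥)
  free : Module.Free ℤ P
  isBaseChange : IsBaseChange ℂ P.subtype
  integral : ∀ (i : I) (v : Module.Dual ℂ 𝔥), v ∈ P → ∃ n : ℤ, v (R.coroot i) = (n : ℂ)
  root_mem : ∀ i, R.root i ∈ P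

namespace WeightLattice

variable {R : Realization A 𝔥} (L : WeightLattice R)

/-- The simple root `α_i` as an element of the weight lattice. -/
def simpleRoot (i : I) : L.P := ⟨R.root i, L.root_mem i⟩

/-- The integer `⟨h_i, λ⟩` for a weight `λ`. -/
def pairing (i : I) (v : L.P) : ℤ := (L.integral i v v.2).choose

theorem pairing_spec (i : I) (v : L.P) :
    (v : Module.Dual ℂ 𝔥) (R.coroot i) = (L.pairing i v : ℂ) :=
  (L.integral i v v.2).choose_spec

end WeightLattice

/-- `(B, wt, ε, φ, e, f)` is a Kashiwara crystal for the generalized Cartan matrix `A` and the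
weight lattice `L`. Here `WithBot ℤ` is `ℤ ⊔ {-∞}`, with `-∞ + x = -∞`, and `Option B` is
`B ⊔ {0}`, with `none` in the role of `0`. -/
structure IsCrystal {R : Realization A 𝔥} (L : WeightLattice R) {B : Type*} (wt : B → L.P)
    (ε φ : I → B → WithBot ℤ) (e f : I → B → Option B) : Prop where
  isGCM : IsGCM A
  phi_eq : ∀ i b, φ i b = ε i b + ((L.pairing i (wt b) : ℤ) : WithBot ℤ)
  e_apply : ∀ i b b', e i b = some b' →
    wt b' = wt b + L.simpleRoot i ∧
    ε i b' = ε i b + ((-1 : ℤ) : WithBot ℤ) ∧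
    φ i b' = φ i b + ((1 : ℤ) : WithBot ℤ)
  f_apply : ∀ i b b', f i b = some b' →
    wt b' = wt b - L.simpleRoot i ∧
    ε i b' = ε i b + ((1 : ℤ) : WithBot ℤ) ∧
    φ i b' = φ i b + ((-1 : ℤ) : WithBot ℤ)
  e_iff_f : ∀ i b b', e i b' = some b ↔ f i b = some b'
  bot : ∀ i b, φ i b = ⊥ → e i b = none ∧ f i b = none

end Crystals

/-! ## The equioriented commutative grid -/

section Grid

variable {d : ℕ}

/-- The vertices `[1, m_1] × ⋯ × [1, m_d]` of the grid, with coordinates counted from `0`. -/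
def Vertex (m : Fin d → ℕ) : Type := ∀ l, Fin (m l)

instance (m : Fin d → ℕ) : Fintype (Vertex m) := inferInstanceAs (Fintype (∀ l, Fin (m l)))

instance (m : Fin d → ℕ) : DecidableEq (Vertex m) :=
  inferInstanceAs (DecidableEq (∀ l, Fin (m l)))

variable {m : Fin d → ℕ}

/-- There is an arrow `i → j` if `j` is obtained from `i` by raising one coordinate by one. -/
def IsArrow (i j : Vertex m) : Prop :=
  ∃ l, (i l : ℕ) + 1 = (j l : ℕ) ∧ ∀ k, k ≠ l → i k = j k

/-- The quiver of the grid: at most one arrow between two vertices. -/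
instance : Quiver (Vertex m) where
  Hom i j := PLift (IsArrow i j)

/-- The lexicographic order on the vertices. -/
def LexLT (i j : Vertex m) : Prop :=
  @toLex (∀ l, Fin (m l)) i < @toLex (∀ l, Fin (m l)) j

/-- The generalized Cartan matrix of the quiver: `2` on the diagonal, and minus the number of
arrows between `i` and `j`, in both directions, off the diagonal. -/
def cartan (m : Fin d → ℕ) : Matrix (Vertex m) (Vertex m) ℤ := fun i j =>
  if i = j then 2 else -(Nat.card (i ⟶ j) : ℤ) - (Nat.card (j ⟶ i) : ℤ)

end Grid

/-! ## Representations and the representation variety -/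

section Representations

variable {d : ℕ} {m : Fin d → ℕ} (k K : Type*) [Field k] [Field K] [Algebra k K]

/-- The space `∏_{τ ∈ E} Hom(K^{ν_{s(τ)}}, K^{ν_{t(τ)}})`. -/
abbrev Rep (ν : Vertex m → ℕ) : Type _ :=
  ∀ ⦃i j : Vertex m⦄, (i ⟶ j) → ((Fin (ν i) → K) →ₗ[K] (Fin (ν j) → K))

variable {K} in
/-- The evaluation of a representation on a path. -/
def Rep.eval {ν : Vertex m → ℕ} (f : Rep K ν) {i : Vertex m} :
    ∀ {j : Vertex m}, Quiver.Path i j → ((Fin (ν i) → K) →ₗ[K] (Fin (ν j) → K))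
  | _, .nil => LinearMap.id
  | _, .cons p τ => f τ ∘ₗ Rep.eval f p

variable {K} in
/-- The commutative relations: any two parallel paths are identical. -/
def Rep.Commutes {ν : Vertex m → ℕ} (f : Rep K ν) : Prop :=
  ∀ (i j : Vertex m) (p q : Quiver.Path i j), f.eval p = f.eval q

/-- The indices of the matrix entries of a representation with dimension vector `ν`. -/
abbrev Entry (ν : Vertex m → ℕ) : Type :=
  Σ e : (Σ i j : Vertex m, (i ⟶ j)), Fin (ν e.2.1) × Fin (ν e.1)

variable {K} in
/-- The matrix entries of a representation. -/
def Rep.entries {ν : Vertex m → ℕ} (f : Rep K ν) : Entry ν → K :=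
  fun c => LinearMap.toMatrix' (f c.1.2.2) c.2.1 c.2.2

/-- The Zariski topology over `k` on the affine space `K^σ`: the closed sets are the sets of
common zeros in `K^σ` of polynomials with coefficients in `k`. -/
abbrev zariskiTopology (σ : Type*) : TopologicalSpace (σ → K) :=
  TopologicalSpace.ofClosed (Set.range (MvPolynomial.zeroLocus (k := k) (σ := σ) K))
    ⟨⊤, MvPolynomial.zeroLocus_top⟩
    (by
      intro T hT
      refine ⟨Ideal.span {p | ∃ I : Ideal (MvPolynomial σ k),
        MvPolynomial.zeroLocus K I ∈ T ∧ p ∈ I}, ?_⟩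
      ext x
      rw [MvPolynomial.zeroLocus_span]
      simp only [Set.mem_ofPred_eq, Set.mem_sInter]
      constructor
      · intro h Z hZ
        obtain ⟨I, rfl⟩ := hT hZ
        exact fun p hp => h p ⟨I, hZ, hp⟩
      · rintro h p ⟨I, hI, hp⟩
        exact h _ hI p hp)
    (by
      rintro _ ⟨I, rfl⟩ _ ⟨J, rfl⟩
      refine ⟨I * J, ?_⟩
      ext x
      simp only [MvPolynomial.mem_zeroLocus_iff, Set.mem_union]
      constructor
      · intro h
        by_contra hc
        push Not at hc
        obtain ⟨⟨p, hp, hpx⟩, q, hq, hqx⟩ := hc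
        have := h (p * q) (Ideal.mul_mem_mul hp hq)
        rw [map_mul] at this
        exact (mul_ne_zero hpx hqx) this
      · rintro (h | h) p hp
        · exact h p ((Ideal.mul_le_left : I * J ≤ I) hp)
        · exact h p ((Ideal.mul_le_right : I * J ≤ J) hp))

/-- The representation variety `E_C(ν)`, as the set of its `K`-points. Its topology is the
Zariski topology over the base field `k`, defined below. -/
def EC (_k K : Type*) [Field K] (ν : Vertex m → ℕ) : Type _ := {f : Rep K ν // f.Commutes}

instance (ν : Vertex m → ℕ) : TopologicalSpace (EC k K ν) :=
  (zariskiTopology k K (Entry ν)).induced (fun f => Rep.entries f.1)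

/-- `B_C = ⨆_ν B_C(ν)`, where `B_C(ν)` is the set of irreducible components of `E_C(ν)`. The
weight `ν = - ∑ ν_i α_i` is recorded by the dimension vector `(ν_i)`. -/
abbrev BC (m : Fin d → ℕ) : Type _ :=
  Σ ν : Vertex m → ℕ, {Λ : Set (EC k K ν) // Λ ∈ irreducibleComponents (EC k K ν)}

end Representations

/-! ## The correspondence given by extensions -/

section Extensions

variable {d : ℕ} {m : Fin d → ℕ} (k K : Type*) [Field K]

/-- The variety `E'_C(a, b)` of extensions, with dimension vectors `a` of the subrepresentation
and `b` of the quotient. The dimension vector `n` of the representation in the middle is kept as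
a parameter; exactness forces `n = a + b`, and there are no points for other `n`. -/
structure ExtPoint (a b n : Vertex m → ℕ) where
  sub : ∀ j, (Fin (a j) → K) →ₗ[K] (Fin (n j) → K)
  quot : ∀ j, (Fin (n j) → K) →ₗ[K] (Fin (b j) → K)
  rep : Rep K n
  injective : ∀ j, Function.Injective (sub j)
  exact : ∀ j, Function.Exact (sub j) (quot j)
  surjective : ∀ j, Function.Surjective (quot j)
  commutes : rep.Commutes
  stable : ∀ (i j : Vertex m) (τ : i ⟶ j),
    LinearMap.range (rep τ ∘ₗ sub i) ≤ LinearMap.range (sub j)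

variable {K} {a b n : Vertex m → ℕ}

/-- The map induced on the quotients along an arrow. -/
theorem ExtPoint.exists_quotMap (x : ExtPoint K a b n) {i j : Vertex m} (τ : i ⟶ j) :
    ∃ g : (Fin (b i) → K) →ₗ[K] (Fin (b j) → K), g ∘ₗ x.quot i = x.quot j ∘ₗ x.rep τ := by
  obtain ⟨s, hs⟩ := (x.quot i).exists_rightInverse_of_surjective
    (LinearMap.range_eq_top.2 (x.surjective i))
  refine ⟨x.quot j ∘ₗ x.rep τ ∘ₗ s, LinearMap.ext fun v => ?_⟩
  have h0 : x.quot i (s (x.quot i v) - v) = 0 := by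
    have := LinearMap.congr_fun hs (x.quot i v)
    simp only [LinearMap.comp_apply, LinearMap.id_apply] at this
    rw [map_sub, this, sub_self]
  obtain ⟨w, hw⟩ := (x.exact i _).1 h0
  obtain ⟨u, hu⟩ := x.stable i j τ ⟨w, rfl⟩
  have h1 : x.quot j (x.rep τ (s (x.quot i v) - v)) = 0 := by
    rw [← hw]
    exact (x.exact j _).2 ⟨u, hu⟩
  rw [map_sub, map_sub, sub_eq_zero] at h1
  exact h1

/-- The quotient representation `f'` of a point of the variety of extensions: the unique
representation with `f'_τ ∘ φ'_{s(τ)} = φ'_{t(τ)} ∘ f_τ`. -/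
def ExtPoint.quotRep (x : ExtPoint K a b n) : Rep K b := fun _ _ τ => (x.exists_quotMap τ).choose

theorem ExtPoint.quotRep_comp (x : ExtPoint K a b n) {i j : Vertex m} (τ : i ⟶ j) :
    x.quotRep τ ∘ₗ x.quot i = x.quot j ∘ₗ x.rep τ :=
  (x.exists_quotMap τ).choose_spec

theorem ExtPoint.quotRep_eval (x : ExtPoint K a b n) {i j : Vertex m} (p : Quiver.Path i j) :
    x.quotRep.eval p ∘ₗ x.quot i = x.quot j ∘ₗ x.rep.eval p := by
  induction p with
  | nil => rfl
  | cons p τ ih =>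
    simp only [Rep.eval]
    rw [LinearMap.comp_assoc, ih, ← LinearMap.comp_assoc, x.quotRep_comp, LinearMap.comp_assoc]

theorem ExtPoint.quotRep_commutes (x : ExtPoint K a b n) : x.quotRep.Commutes := by
  intro i j p q
  rw [← LinearMap.cancel_right (x.surjective i), x.quotRep_eval, x.quotRep_eval,
    x.commutes i j p q]

/-- `ϖ₃`: the quotient representation. -/
def varpi3 (x : ExtPoint K a b n) : EC k K b := ⟨x.quotRep, x.quotRep_commutes⟩

/-- `ϖ₄`: the representation in the middle. -/
def varpi4 (x : ExtPoint K a b n) : EC k K n := ⟨x.rep, x.commutes⟩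

end Extensions

/-! ## The star-crystal data -/

section StarCrystal

variable {d : ℕ} {m : Fin d → ℕ} {k K : Type*} [Field k] [Field K] [Algebra k K]

/-- `ε*_i(f)`: the dimension of the kernel of
`(f_τ)_{s(τ) = i} : K^{ν_i} → ⨁_{s(τ) = i} K^{ν_{t(τ)}}`. -/
def epsStarPt {ν : Vertex m → ℕ} (i : Vertex m) (f : EC k K ν) : ℕ :=
  Module.finrank K (LinearMap.ker
    (LinearMap.pi (fun τ : (Σ j : Vertex m, (i ⟶ j)) => f.1 τ.2)))

/-- `in₁(i)`. -/
def in1 (i : Vertex m) : Set (Vertex m) := {j | IsArrow j i}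

/-- `in₂(i)`. -/
def in2 (i : Vertex m) : Set (Vertex m) :=
  {l | ∃ j₁ ∈ in1 i, ∃ j₂ ∈ in1 i, j₁ ≠ j₂ ∧ IsArrow l j₁ ∧ IsArrow l j₂}

/-- The transpose of a linear map between coordinate spaces. -/
def transposeMap {p q : ℕ} (g : (Fin p → K) →ₗ[K] (Fin q → K)) :
    (Fin q → K) →ₗ[K] (Fin p → K) :=
  Matrix.toLin' (LinearMap.toMatrix' g).transpose

open Classical in
/-- The component `K^{ν_j} → K^{ν_l}` of `F_i(f)`, for `j ∈ in₁(i)` and `l ∈ in₂(i)`: it is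
`f_{(l,j)}ᵀ` if `l` is the common source `k(j, j')` of arrows to `j` and to some `j' ∈ in₁(i)`
with `j < j'`, it is `-f_{(l,j)}ᵀ` if this holds with `j' < j`, and `0` otherwise. -/
def FStarComp {ν : Vertex m → ℕ} (i : Vertex m) (f : EC k K ν) (j l : Vertex m) :
    (Fin (ν j) → K) →ₗ[K] (Fin (ν l) → K) :=
  if h : IsArrow l j ∧ ∃ j' ∈ in1 i, LexLT j j' ∧ IsArrow l j' then
    transposeMap (f.1 (PLift.up h.1))
  else if h : IsArrow l j ∧ ∃ j' ∈ in1 i, LexLT j' j ∧ IsArrow l j' then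
    -transposeMap (f.1 (PLift.up h.1))
  else 0

open Classical in
/-- `F_i(f) : ⨁_{j ∈ in₁(i)} K^{ν_j} → ⨁_{l ∈ in₂(i)} K^{ν_l}`. -/
def FStar {ν : Vertex m → ℕ} (i : Vertex m) (f : EC k K ν) :
    ((j : in1 i) → Fin (ν j) → K) →ₗ[K] ((l : in2 i) → Fin (ν l) → K) :=
  LinearMap.pi fun l => ∑ j : in1 i, FStarComp i f j l ∘ₗ LinearMap.proj j

/-- The space `(ker F_i(f))*`, which parametrizes the extensions by a simple subrepresentation
at `i`. -/
abbrev ExtStar {ν : Vertex m → ℕ} (i : Vertex m) (f : EC k K ν) : Type _ :=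
  Module.Dual K (LinearMap.ker (FStar i f))

/-- The points of `Λ` at which `g` takes its minimum on `Λ`. -/
def minLocus {X : Type*} (g : X → ℕ) (Λ : Set X) : Set X := {x ∈ Λ | ∀ y ∈ Λ, g x ≤ g y}

/-- `Λ³`: the points `f` of `Λ` where `dim (ker F_i(f))*` is minimal. -/
def locus3 {ν : Vertex m → ℕ} (i : Vertex m) (Λ : Set (EC k K ν)) : Set (EC k K ν) :=
  minLocus (fun f => Module.finrank K (ExtStar i f)) Λ

/-- `Λ⁴`: the points of `Λ` where `ε*_i` is minimal. -/
def locus4 {ν : Vertex m → ℕ} (i : Vertex m) (Λ : Set (EC k K ν)) : Set (EC k K ν) :=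
  minLocus (epsStarPt i) Λ

/-- `ε*_i(Λ)`: the minimum of `ε*_i` on the (non-empty) component `Λ`. -/
def epsStarNat (i : Vertex m) (b : BC k K m) : ℕ := sInf (epsStarPt i '' b.2.1)

/-- `ε*_i` with values in `ℤ ⊔ {-∞}`. -/
def epsStar (i : Vertex m) (b : BC k K m) : WithBot ℤ := ((epsStarNat i b : ℤ) : WithBot ℤ)

/-- The dimension vector `δ_i` of the simple representation at `i`, that is, of the weight
`-α_i`. -/
abbrev simpleDim (i : Vertex m) : Vertex m → ℕ := Pi.single i 1

/-- The closure of `ϖ₄(ϖ₃⁻¹(Λ³))` for `Λ ⊂ E_C(μ)`, in the correspondence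
`E_C(μ) ← E'_C(δ_i, μ) → E_C(μ + δ_i)`. -/
def fStarSet (i : Vertex m) {μ : Vertex m → ℕ} (Λ : Set (EC k K μ)) :
    Set (EC k K (μ + simpleDim i)) :=
  closure (varpi4 k '' ((varpi3 k : ExtPoint K (simpleDim i) μ (μ + simpleDim i) → EC k K μ) ⁻¹'
    locus3 i Λ))

/-- The closure of `ϖ₃(ϖ₄⁻¹(Λ⁴))` for `Λ ⊂ E_C(ν)`, in the correspondence
`E_C(ν - δ_i) ← E'_C(δ_i, ν - δ_i) → E_C(ν)`. It is used only if `ν_i > 0`. -/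
def eStarSet (i : Vertex m) {ν : Vertex m → ℕ} (Λ : Set (EC k K ν)) :
    Set (EC k K (ν - simpleDim i)) :=
  closure (varpi3 k '' ((varpi4 k : ExtPoint K (simpleDim i) (ν - simpleDim i) ν → EC k K ν) ⁻¹'
    locus4 i Λ))

open Classical in
/-- The operator `f̃*_i`. -/
def fStar (i : Vertex m) (b : BC k K m) : Option (BC k K m) :=
  if h : fStarSet i b.2.1 ∈ irreducibleComponents (EC k K (b.1 + simpleDim i)) then
    some ⟨b.1 + simpleDim i, fStarSet i b.2.1, h⟩
  else none

open Classical in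
/-- The operator `ẽ*_i`. -/
def eStar (i : Vertex m) (b : BC k K m) : Option (BC k K m) :=
  if h : 0 < epsStarNat i b ∧
      eStarSet i b.2.1 ∈ irreducibleComponents (EC k K (b.1 - simpleDim i)) then
    some ⟨b.1 - simpleDim i, eStarSet i b.2.1, h.2⟩
  else none

variable {𝔥 : Type*} [AddCommGroup 𝔥] [Module ℂ 𝔥] {R : Realization (cartan m) 𝔥}

/-- The weight `- ∑ ν_i α_i` of a component of `E_C(ν)`. -/
def weight (L : WeightLattice R) (b : BC k K m) : L.P :=
  -∑ i : Vertex m, (b.1 i : ℤ) • L.simpleRoot i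

/-- `φ*_i(Λ) = ε*_i(Λ) + ⟨h_i, wt(Λ)⟩`. -/
def phiStar (L : WeightLattice R) (i : Vertex m) (b : BC k K m) : WithBot ℤ :=
  epsStar i b + ((L.pairing i (weight L b) : ℤ) : WithBot ℤ)

end StarCrystal

end PersistenceCrystal

end

noncomputable section

namespace PersistenceCrystal

/-! ## Maximal minors -/

section Minors

variable {K : Type*} [Field K] {ρ τ : Type*} [Fintype ρ] [Fintype τ]

/-! The heart of the theorem is axiom 4, that `eStar` and `fStar` are partial inverses. The
remaining axioms are bookkeeping. The one-dimensional subspace added at `i` is killed by all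
outgoing arrows, and passing to the quotient changes nothing else about them, so an extension raises
`ε*_i` by exactly one (`ExtPoint.epsStarPt_varpi4`). The change of `φ*_i` then follows from `A i i =
2`.

After a change of bases every extension has the standard coordinate inclusion and projection
(`ExtPoint.exists_isQuot`). Over a fixed quotient `f'`, such an extension amounts to one new last
row for each arrow into `i`. The squares ending in `i` commute exactly when these rows lie in `ker
F_i(f')` (`extRep_commutes_iff`). Over a fixed middle term `f`, an extension amounts, up to bases,
to a nonzero vector in the kernel whose dimension is `ε*_i(f)`. On `Λ³` and `Λ⁴` these kernels have
constant dimension, hence form irreducible families, and both correspondences carry irreducible sets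
to irreducible sets (`isPreirr_stdExt`, `isPreirr_hasQuot`, `isPreirr_stdQuots`). The union of the
orbits of an irreducible set is irreducible as well (`IsPreirr.orbits`).

Components are maximal, so the closure of an irreducible set equals a component as soon as it
contains it (`closure_eq_of_subset_closure`). Axiom 4 thus becomes two density statements,
`closure_stdQuots_eq` and `closure_stdExt_eq`. Both use that nonempty open subsets of an irreducible
set meet and are dense.

Since closed sets are cut out over `k` while points have coordinates in `K`, irreducibility is
expressed by nonvanishing of functions from a `k`-algebra (`IsPreirr`). It survives products with
affine space because `K` is infinite (`IsPreirr.prod`), and images under maps with rational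
coordinates (`IsPreirr.image`). Cramer's rule parametrizes kernels of constant rank
(`exists_kernel_param`), which yields `IsPreirr.kernels`. -/

theorem exists_rows_linearIndependent (M : Matrix ρ τ K) {r : ℕ} (hr : M.rank = r) :
    ∃ R : Fin r → ρ, LinearIndependent K (M.submatrix R id).row := by
  subst hr
  obtain ⟨f, hf, -, hli⟩ := Submodule.exists_fun_fin_finrank_span_eq K (Set.range M.row)
  choose R hR using hf
  have e : Module.finrank K (Submodule.span K (Set.range M.row)) = M.rank :=
    M.rank_eq_finrank_span_row.symm
  refine ⟨R ∘ Fin.cast e.symm, ?_⟩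
  have : (M.submatrix (R ∘ Fin.cast e.symm) id).row = f ∘ Fin.cast e.symm := by
    funext i
    exact hR _
  rw [this]
  exact hli.comp _ (Fin.cast_injective _)

/-- A matrix of rank `r` has a nonvanishing minor of size `r`. -/
theorem exists_submatrix_det_ne_zero (M : Matrix ρ τ K) {r : ℕ} (hr : M.rank = r) :
    ∃ (R : Fin r → ρ) (C : Fin r → τ), (M.submatrix R C).det ≠ 0 := by
  obtain ⟨R, hR⟩ := exists_rows_linearIndependent M hr
  have h1 : (M.submatrix R id).transpose.rank = r := by
    rw [Matrix.rank_transpose, hR.rank_matrix, Fintype.card_fin]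
  obtain ⟨C, hC⟩ := exists_rows_linearIndependent _ h1
  refine ⟨R, C, ?_⟩
  rw [← Matrix.det_transpose, ← isUnit_iff_ne_zero, ← Matrix.isUnit_iff_isUnit_det]
  exact Matrix.linearIndependent_rows_iff_isUnit.1 hC

end Minors

/-! ## Irreducibility with respect to a ring of functions -/

section RegularFunctions

variable {k K : Type*} [Field k] [Field K] [Algebra k K] {X Y : Type*}

/-- A set is (pre-)irreducible in the topology whose closed sets are the common zeros of families
of functions in `A`. -/
def IsPreirr (A : Subalgebra k (X → K)) (S : Set X) : Prop :=
  ∀ a ∈ A, ∀ b ∈ A, (∃ x ∈ S, a x ≠ 0) → (∃ x ∈ S, b x ≠ 0) → ∃ x ∈ S, a x ≠ 0 ∧ b x ≠ 0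

variable {A : Subalgebra k (X → K)} {S : Set X}

/-- Multiplying one test function by the local witness `u` forces the common nonvanishing point into
`S'`. -/
theorem IsPreirr.of_locally_open (hS : IsPreirr A S) {S' : Set X} (hS' : S' ⊆ S)
    (h : ∀ x ∈ S', ∃ u ∈ A, u x ≠ 0 ∧ ∀ y ∈ S, u y ≠ 0 → y ∈ S') : IsPreirr A S' := by
  rintro a ha b hb ⟨x, hx, hax⟩ ⟨y, hy, hby⟩
  obtain ⟨u, hu, hux, huS⟩ := h x hx
  obtain ⟨z, hz, h1, h2⟩ := hS (a * u) (A.mul_mem ha hu) b hb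
    ⟨x, hS' hx, mul_ne_zero hax hux⟩ ⟨y, hS' hy, hby⟩
  rw [Pi.mul_apply] at h1
  exact ⟨z, huS z hz (right_ne_zero_of_mul h1), left_ne_zero_of_mul h1, h2⟩

variable (A S) in
/-- The functions that are on `S` quotients of functions in `A`. -/
def ratOn : Subalgebra k (X → K) where
  carrier := {g | ∃ u ∈ A, ∃ a ∈ A, ∀ x ∈ S, u x ≠ 0 ∧ a x = u x * g x}
  mul_mem' := by
    rintro g g' ⟨u, hu, a, ha, h⟩ ⟨u', hu', a', ha', h'⟩
    refine ⟨u * u', A.mul_mem hu hu', a * a', A.mul_mem ha ha', fun x hx => ?_⟩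
    simp only [Pi.mul_apply, (h x hx).2, (h' x hx).2]
    exact ⟨mul_ne_zero (h x hx).1 (h' x hx).1, by ring⟩
  add_mem' := by
    rintro g g' ⟨u, hu, a, ha, h⟩ ⟨u', hu', a', ha', h'⟩
    refine ⟨u * u', A.mul_mem hu hu', a * u' + u * a',
      A.add_mem (A.mul_mem ha hu') (A.mul_mem hu ha'), fun x hx => ?_⟩
    simp only [Pi.mul_apply, Pi.add_apply, (h x hx).2, (h' x hx).2]
    exact ⟨mul_ne_zero (h x hx).1 (h' x hx).1, by ring⟩
  algebraMap_mem' c := ⟨1, A.one_mem, _, A.algebraMap_mem c, fun x _ => by simp⟩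

theorem le_ratOn : A ≤ ratOn A S := fun a ha => ⟨1, A.one_mem, a, ha, fun x _ => by simp⟩

theorem inv_mem_ratOn {g : X → K} (hg : g ∈ ratOn A S) (h0 : ∀ x ∈ S, g x ≠ 0) :
    (fun x => (g x)⁻¹) ∈ ratOn A S := by
  obtain ⟨u, hu, a, ha, h⟩ := hg
  refine ⟨a, ha, u, hu, fun x hx => ?_⟩
  rw [(h x hx).2]
  have := h0 x hx
  exact ⟨mul_ne_zero (h x hx).1 this, by field_simp⟩

/-- On `S` a quotient vanishes exactly where its numerator does, so admitting denominators does not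
change the topology of `S`. -/
theorem IsPreirr.ratOn (hS : IsPreirr A S) : IsPreirr (ratOn A S) S := by
  rintro g ⟨u, hu, a, ha, h⟩ g' ⟨u', hu', a', ha', h'⟩ ⟨x, hx, hgx⟩ ⟨y, hy, hgy⟩
  obtain ⟨z, hz, h1, h2⟩ := hS a ha a' ha'
    ⟨x, hx, by rw [(h x hx).2]; exact mul_ne_zero (h x hx).1 hgx⟩
    ⟨y, hy, by rw [(h' y hy).2]; exact mul_ne_zero (h' y hy).1 hgy⟩
  rw [(h z hz).2] at h1
  rw [(h' z hz).2] at h2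
  exact ⟨z, hz, right_ne_zero_of_mul h1, right_ne_zero_of_mul h2⟩

theorem IsPreirr.image (hS : IsPreirr A S) (φ : X → Y) {B : Subalgebra k (Y → K)}
    (h : ∀ b ∈ B, b ∘ φ ∈ PersistenceCrystal.ratOn A S) : IsPreirr B (φ '' S) := by
  rintro b hb b' hb' ⟨_, ⟨x, hx, rfl⟩, hbx⟩ ⟨_, ⟨y, hy, rfl⟩, hby⟩
  obtain ⟨z, hz, h1, h2⟩ := hS.ratOn _ (h b hb) _ (h b' hb') ⟨x, hx, hbx⟩ ⟨y, hy, hby⟩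
  exact ⟨_, ⟨z, hz, rfl⟩, h1, h2⟩

variable (A) in
/-- The ring of functions on `X × K^τ` generated by the functions in `A` and the coordinates. -/
def polyExt (τ : Type*) : Subalgebra k (X × (τ → K) → K) :=
  Algebra.adjoin k ({g | ∃ a ∈ A, g = fun p => a p.1} ∪ Set.range fun (t : τ) p => p.2 t)

variable {τ : Type*}

theorem fst_mem_polyExt {a : X → K} (ha : a ∈ A) :
    (fun p : X × (τ → K) => a p.1) ∈ polyExt A τ :=
  Algebra.subset_adjoin (Or.inl ⟨a, ha, rfl⟩)

theorem coord_mem_polyExt (t : τ) : (fun p : X × (τ → K) => p.2 t) ∈ polyExt A τ :=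
  Algebra.subset_adjoin (Or.inr ⟨t, rfl⟩)

/-- Evaluation of functions at a point. -/
def evalAt (A : Subalgebra k (X → K)) (x : X) : A →+* K :=
  (Pi.evalRingHom (fun _ : X => K) x).comp A.val.toRingHom

@[simp] theorem evalAt_apply (x : X) (a : A) : evalAt A x a = (a : X → K) x := rfl

/-- One polynomial with coefficients in `A` serves all fibres: restriction to the fibre over `x` is
specialization of its coefficients at `x`. -/
theorem exists_polynomial_of_mem_polyExt {a : X × (τ → K) → K} (ha : a ∈ polyExt A τ) :
    ∃ P : MvPolynomial τ A, ∀ x w, a (x, w) = MvPolynomial.eval₂ (evalAt A x) w P := by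
  induction ha using Algebra.adjoin_induction with
  | mem g hg =>
    rcases hg with ⟨a, ha, rfl⟩ | ⟨t, rfl⟩
    · exact ⟨MvPolynomial.C ⟨a, ha⟩, fun x w => by simp⟩
    · exact ⟨MvPolynomial.X t, fun x w => by simp⟩
  | algebraMap c => exact ⟨MvPolynomial.C (algebraMap k A c), fun x w => by simp⟩
  | add g g' _ _ h h' =>
    obtain ⟨P, hP⟩ := h
    obtain ⟨Q, hQ⟩ := h'
    exact ⟨P + Q, fun x w => by simp [hP, hQ]⟩
  | mul g g' _ _ h h' =>
    obtain ⟨P, hP⟩ := h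
    obtain ⟨Q, hQ⟩ := h'
    exact ⟨P * Q, fun x w => by simp [hP, hQ]⟩

/-- A function on `X × K^τ` which does not vanish at some point over `x` does not vanish
identically over the points of some neighbourhood of `x`. -/
theorem exists_mem_of_polyExt_ne_zero [Infinite K] {P : MvPolynomial τ A} {x : X} {w : τ → K}
    (h : MvPolynomial.eval₂ (evalAt A x) w P ≠ 0) :
    ∃ u ∈ A, u x ≠ 0 ∧ ∀ y, u y ≠ 0 → MvPolynomial.map (evalAt A y) P ≠ 0 := by
  have h1 : MvPolynomial.map (evalAt A x) P ≠ 0 := by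
    intro h0
    rw [MvPolynomial.eval₂_eq_eval_map, h0, map_zero] at h
    exact h rfl
  -- A coefficient that survives at `x` is itself a function in `A`, and serves as `u`.
  obtain ⟨s, hs⟩ := MvPolynomial.ne_zero_iff.1 h1
  rw [MvPolynomial.coeff_map] at hs
  refine ⟨(P.coeff s).1, (P.coeff s).2, hs, fun y hy h0 => hy ?_⟩
  have := congrArg (MvPolynomial.coeff s) h0
  rwa [MvPolynomial.coeff_map] at this

/-- Nonvanishing somewhere on the fibre over a point is an open condition on that point.
Irreducibility of the base finds one fibre where both functions are nonzero polynomials, and affine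
space over an infinite field is irreducible. -/
theorem IsPreirr.prod [Infinite K] (hS : IsPreirr A S) :
    IsPreirr (polyExt A τ) {p | p.1 ∈ S} := by
  rintro a ha b hb ⟨⟨x, w⟩, hx, hax⟩ ⟨⟨y, v⟩, hy, hby⟩
  obtain ⟨P, hP⟩ := exists_polynomial_of_mem_polyExt ha
  obtain ⟨Q, hQ⟩ := exists_polynomial_of_mem_polyExt hb
  rw [hP] at hax
  rw [hQ] at hby
  obtain ⟨u, hu, hux, huP⟩ := exists_mem_of_polyExt_ne_zero hax
  obtain ⟨v, hv, hvy, hvQ⟩ := exists_mem_of_polyExt_ne_zero hby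
  obtain ⟨z, hz, huz, hvz⟩ := hS u hu v hv ⟨x, hx, hux⟩ ⟨y, hy, hvy⟩
  have h0 := mul_ne_zero (huP z huz) (hvQ z hvz)
  obtain ⟨w, hw⟩ : ∃ w, MvPolynomial.eval w
      (MvPolynomial.map (evalAt A z) P * MvPolynomial.map (evalAt A z) Q) ≠ 0 := by
    by_contra hc
    push Not at hc
    exact h0 (MvPolynomial.funext fun w => by rw [hc, map_zero])
  rw [map_mul] at hw
  refine ⟨(z, w), hz, ?_, ?_⟩
  · rw [hP, MvPolynomial.eval₂_eq_eval_map]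
    exact left_ne_zero_of_mul hw
  · rw [hQ, MvPolynomial.eval₂_eq_eval_map]
    exact right_ne_zero_of_mul hw

/-- A map into a product is regular if its components are. -/
theorem polyExt_comp_mem {Z : Type*} {C : Subalgebra k (Z → K)} {φ : Z → X × (τ → K)}
    (h1 : ∀ a ∈ A, (fun z => a (φ z).1) ∈ C) (h2 : ∀ t, (fun z => (φ z).2 t) ∈ C)
    {b : X × (τ → K) → K} (hb : b ∈ polyExt A τ) : b ∘ φ ∈ C := by
  induction hb using Algebra.adjoin_induction with
  | mem g hg =>
    rcases hg with ⟨a, ha, rfl⟩ | ⟨t, rfl⟩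
    · exact h1 a ha
    · exact h2 t
  | algebraMap c => exact C.algebraMap_mem c
  | add g g' _ _ h h' => exact C.add_mem h h'
  | mul g g' _ _ h h' => exact C.mul_mem h h'

/-! ### Matrices of functions -/

variable {ρ σ : Type*}

variable (A) in
/-- All entries of a matrix-valued function lie in `A`. -/
def MatReg (M : X → Matrix ρ σ K) : Prop := ∀ i j, (fun x => M x i j) ∈ A

theorem MatReg.mul [Fintype σ] {M : X → Matrix ρ σ K} {N : X → Matrix σ τ K} (hM : MatReg A M)
    (hN : MatReg A N) : MatReg A fun x => M x * N x := by
  intro i j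
  have : (fun x => (M x * N x) i j) = ∑ s, (fun x => M x i s) * fun x => N x s j := by
    funext x
    simp [Matrix.mul_apply]
  rw [this]
  exact A.sum_mem fun s _ => A.mul_mem (hM i s) (hN s j)

theorem const_mem_of_zero_one (c : Prop) [Decidable c] :
    (fun _ : X => if c then (1 : K) else 0) ∈ A := by
  split_ifs
  · exact A.one_mem
  · exact A.zero_mem

theorem MatReg.det [Fintype σ] [DecidableEq σ] {M : X → Matrix σ σ K} (hM : MatReg A M) :
    (fun x => (M x).det) ∈ A := by
  have : (fun x => (M x).det) =
      ∑ s : Equiv.Perm σ, Equiv.Perm.sign s • ∏ i, fun x => M x (s i) i := by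
    funext x
    simp [Matrix.det_apply]
  rw [this]
  refine A.sum_mem fun s _ => ?_
  have hp : (∏ i, fun x => M x (s i) i) ∈ A := A.prod_mem fun i _ => hM _ _
  rcases Int.units_eq_one_or (Equiv.Perm.sign s) with h | h <;> rw [h]
  · simpa using hp
  · simpa using A.neg_mem hp

theorem MatReg.adjugate [Fintype σ] [DecidableEq σ] {M : X → Matrix σ σ K} (hM : MatReg A M) :
    MatReg A fun x => (M x).adjugate := by
  intro i j
  simp only [Matrix.adjugate_apply]
  refine MatReg.det (M := fun x => (M x).updateRow j (Pi.single i 1)) fun a b => ?_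
  simp only [Matrix.updateRow_apply]
  split_ifs
  · simp only [Pi.single_apply]
    exact const_mem_of_zero_one _
  · exact hM a b

theorem MatReg.inv_ratOn [Fintype σ] [DecidableEq σ] {M : X → Matrix σ σ K}
    (hM : MatReg (PersistenceCrystal.ratOn A S) M)
    (h0 : ∀ x ∈ S, (M x).det ≠ 0) : MatReg (PersistenceCrystal.ratOn A S) fun x => (M x)⁻¹ := by
  intro i j
  have : (fun x => (M x)⁻¹ i j) = (fun x => ((M x).det)⁻¹) * fun x => (M x).adjugate i j := by
    funext x
    simp [Matrix.inv_def]
  rw [this]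
  exact Subalgebra.mul_mem _ (inv_mem_ratOn hM.det h0) (hM.adjugate i j)

theorem mulVec_coord_mem_polyExt [Fintype σ] {N : X → Matrix σ σ K} (hN : MatReg A N) (t : σ) :
    (fun p : X × (σ → K) => (N p.1).mulVec p.2 t) ∈ polyExt A σ := by
  have : (fun p : X × (σ → K) => (N p.1).mulVec p.2 t) =
      ∑ s, (fun p => N p.1 t s) * fun p => p.2 s := by
    funext p
    simp [Matrix.mulVec, dotProduct]
  rw [this]
  exact Subalgebra.sum_mem _ fun s _ =>
    Subalgebra.mul_mem _ (fst_mem_polyExt (hN t s)) (coord_mem_polyExt s)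

theorem rank_eq_of_finrank_ker_eq [Fintype σ] {M N : Matrix ρ σ K}
    (h : Module.finrank K (LinearMap.ker M.mulVecLin) =
      Module.finrank K (LinearMap.ker N.mulVecLin)) : M.rank = N.rank := by
  have h1 := M.mulVecLin.finrank_range_add_finrank_ker
  have h2 := N.mulVecLin.finrank_range_add_finrank_ker
  have h4 : M.rank = Module.finrank K (LinearMap.range M.mulVecLin) := rfl
  have h5 : N.rank = Module.finrank K (LinearMap.range N.mulVecLin) := rfl
  omega

variable [Fintype ρ] [Fintype σ] [DecidableEq σ]

/-- A family of matrices near a given point: the rank can only increase, and the kernel is given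
by a regular family of matrices `N` as long as the rank is constant. -/
theorem exists_kernel_param {M : X → Matrix ρ σ K} (hM : MatReg A M) (x₀ : X) :
    ∃ D ∈ A, ∃ N : X → Matrix σ σ K, MatReg A N ∧ D x₀ ≠ 0 ∧
      (∀ x, D x ≠ 0 → (M x₀).rank ≤ (M x).rank) ∧
      (∀ x, D x ≠ 0 → (M x).rank = (M x₀).rank → M x * N x = 0) ∧
      ∀ x w, (M x).mulVec w = 0 → (N x).mulVec w = D x • w := by
  classical
  obtain ⟨r, hr₀⟩ : ∃ r, (M x₀).rank = r := ⟨_, rfl⟩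
  obtain ⟨R, C, hRC⟩ := exists_submatrix_det_ne_zero (M x₀) hr₀
  rw [hr₀]
  let Q : X → Matrix (Fin r) (Fin r) K := fun x => (M x).submatrix R C
  have hQ : MatReg A Q := fun i j => hM _ _
  let E : X → Matrix σ (Fin r) K := fun _ => Matrix.of fun s j => if s = C j then 1 else 0
  have hE : MatReg A E := fun s j => const_mem_of_zero_one _
  let MR : X → Matrix (Fin r) σ K := fun x => (M x).submatrix R id
  have hMR : MatReg A MR := fun i j => hM _ _
  have hME : ∀ x, MR x * E x = Q x := by
    intro x
    ext i j
    simp [MR, E, Q, Matrix.mul_apply]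
  -- Cramer's rule: where the minor is invertible, `W` is `det Q` times a projection along the
  -- kernel of the selected rows, so `det Q - W` maps onto that kernel and involves no division.
  let W : X → Matrix σ σ K := fun x => E x * (Q x).adjugate * MR x
  have hW : MatReg A W := (hE.mul hQ.adjugate).mul hMR
  have hrank : ∀ x, (Q x).det ≠ 0 → r ≤ (M x).rank := by
    intro x hx
    have h1 : (Q x).rank = r := by
      rw [Matrix.rank_of_isUnit _ ((Matrix.isUnit_iff_isUnit_det _).2 (isUnit_iff_ne_zero.2 hx)),
        Fintype.card_fin]
    rw [← h1]
    exact Matrix.rank_submatrix_le _ _ _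
  refine ⟨fun x => (Q x).det, hQ.det, fun x => (Q x).det • 1 - W x, ?_, hRC, hrank, ?_, ?_⟩
  · intro i j
    have : (fun x => ((Q x).det • (1 : Matrix σ σ K) - W x) i j) =
        (fun x => (Q x).det) * (fun _ => if i = j then 1 else 0) - fun x => W x i j := by
      funext x
      simp [Matrix.one_apply]
    rw [this]
    exact A.sub_mem (A.mul_mem hQ.det (const_mem_of_zero_one _)) (hW i j)
  · intro x hx hr
    have h0 : MR x * ((Q x).det • 1 - W x) = 0 := by
      rw [Matrix.mul_sub, Matrix.mul_smul, Matrix.mul_one]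
      simp only [W]
      rw [← Matrix.mul_assoc, ← Matrix.mul_assoc, hME, Matrix.mul_adjugate, Matrix.smul_mul,
        Matrix.one_mul, sub_self]
    -- When the rank is still `r`, the selected rows already span the row space, so they cut out the
    -- full kernel.
    have hker : LinearMap.ker (M x).mulVecLin = LinearMap.ker (MR x).mulVecLin := by
      have hle : LinearMap.ker (M x).mulVecLin ≤ LinearMap.ker (MR x).mulVecLin := by
        intro w hw
        rw [LinearMap.mem_ker, Matrix.mulVecLin_apply] at hw ⊢
        funext i
        exact congrFun hw (R i)
      refine Submodule.eq_of_le_of_finrank_le hle ?_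
      have h1 := (M x).mulVecLin.finrank_range_add_finrank_ker
      have h2 := (MR x).mulVecLin.finrank_range_add_finrank_ker
      have h3 : r ≤ (MR x).rank := by
        have h1 : (Q x).rank = r := by
          rw [Matrix.rank_of_isUnit _
            ((Matrix.isUnit_iff_isUnit_det _).2 (isUnit_iff_ne_zero.2 hx)), Fintype.card_fin]
        rw [← hME] at h1
        exact h1.ge.trans (Matrix.rank_mul_le_left _ _)
      have h4 : (MR x).rank = Module.finrank K (LinearMap.range (MR x).mulVecLin) := rfl
      have h5 : (M x).rank = Module.finrank K (LinearMap.range (M x).mulVecLin) := rfl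
      omega
    have h1 : ∀ w, (M x).mulVec ((((Q x).det • 1 - W x)).mulVec w) = 0 := by
      intro w
      have : ((Q x).det • 1 - W x).mulVec w ∈ LinearMap.ker (MR x).mulVecLin := by
        rw [LinearMap.mem_ker, Matrix.mulVecLin_apply, Matrix.mulVec_mulVec, h0,
          Matrix.zero_mulVec]
      rw [← hker] at this
      exact this
    apply Matrix.toLin'.injective
    refine LinearMap.ext fun w => ?_
    rw [Matrix.toLin'_apply, ← Matrix.mulVec_mulVec, h1, map_zero, LinearMap.zero_apply]
  · intro x w hw
    have hMw : (MR x).mulVec w = 0 := by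
      funext i
      exact congrFun hw (R i)
    rw [Matrix.sub_mulVec, Matrix.smul_mulVec, Matrix.one_mulVec, ← Matrix.mulVec_mulVec, hMw,
      Matrix.mulVec_zero, sub_zero]

/-- The kernels of a family of matrices of constant rank over an irreducible base form an
irreducible set. -/
theorem IsPreirr.kernels [Infinite K] (hS : IsPreirr A S) {M : X → Matrix ρ σ K}
    (hM : MatReg A M) (hr : ∀ x ∈ S, ∀ y ∈ S, (M x).rank = (M y).rank) :
    IsPreirr (polyExt A σ) {p | p.1 ∈ S ∧ (M p.1).mulVec p.2 = 0} := by
  -- Locally on the base, the family of kernels is the image of a product with affine space under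
  -- `(x, w) ↦ (x, N x w)`.
  have key : ∀ x₀ ∈ S, ∃ D ∈ A, D x₀ ≠ 0 ∧
      IsPreirr (polyExt A σ) {p | (p.1 ∈ S ∧ (M p.1).mulVec p.2 = 0) ∧ D p.1 ≠ 0} := by
    intro x₀ hx₀
    obtain ⟨D, hD, N, hN, hD0, -, hN1, hN2⟩ := exists_kernel_param hM x₀
    refine ⟨D, hD, hD0, ?_⟩
    have h1 : IsPreirr A {x ∈ S | D x ≠ 0} :=
      hS.of_locally_open (fun x hx => hx.1) fun x hx => ⟨D, hD, hx.2, fun y hy h => ⟨hy, h⟩⟩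
    have h2 := (h1.prod (τ := σ)).image (fun p => (p.1, (N p.1).mulVec p.2))
      (B := polyExt A σ) fun b hb => le_ratOn (polyExt_comp_mem
        (φ := fun p : X × (σ → K) => (p.1, (N p.1).mulVec p.2)) (fun a ha => fst_mem_polyExt ha)
        (fun t => mulVec_coord_mem_polyExt hN t) hb)
    convert h2 using 1
    ext ⟨x, w⟩
    simp only [Set.mem_ofPred_eq, Set.mem_image, Prod.mk.injEq, Prod.exists]
    constructor
    · rintro ⟨⟨hx, hw⟩, hDx⟩
      -- On the kernel `N` acts as the scalar `D`, hence the rescaling.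
      refine ⟨x, (D x)⁻¹ • w, ⟨hx, hDx⟩, rfl, ?_⟩
      rw [Matrix.mulVec_smul, hN2 x w hw, smul_smul, inv_mul_cancel₀ hDx, one_smul]
    · rintro ⟨x', v, ⟨hx', hDx'⟩, rfl, rfl⟩
      refine ⟨⟨hx', ?_⟩, hDx'⟩
      rw [Matrix.mulVec_mulVec, hN1 x' hDx' (hr _ hx' _ hx₀), Matrix.zero_mulVec]
  rintro a ha b hb ⟨⟨x, w⟩, ⟨hx, hw⟩, hax⟩ ⟨⟨y, v⟩, ⟨hy, hv⟩, hby⟩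
  obtain ⟨D, hD, hDx, hirr⟩ := key x hx
  obtain ⟨D', hD', hDy, hirr'⟩ := key y hy
  -- The two local pieces overlap: the zero vector over a common base point `z` lies in both. A
  -- nonvanishing condition can therefore be passed from the first piece to the second.
  obtain ⟨z, hz, hz1, hz2⟩ := hS D hD D' hD' ⟨x, hx, hDx⟩ ⟨y, hy, hDy⟩
  obtain ⟨⟨x', w'⟩, ⟨⟨hx', hw'⟩, -⟩, h1, h2⟩ := hirr a ha _ (fst_mem_polyExt hD')
    ⟨(x, w), ⟨⟨hx, hw⟩, hDx⟩, hax⟩ ⟨(z, 0), ⟨⟨hz, Matrix.mulVec_zero _⟩, hz1⟩, hz2⟩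
  obtain ⟨p, ⟨hp, -⟩, h3, h4⟩ := hirr' a ha b hb ⟨(x', w'), ⟨⟨hx', hw'⟩, h2⟩, h1⟩
    ⟨(y, v), ⟨⟨hy, hv⟩, hDy⟩, hby⟩
  exact ⟨p, hp, h3, h4⟩

/-- The dimension of the kernel of a family of matrices is upper semicontinuous. -/
theorem exists_mem_finrank_ker_le {M : X → Matrix ρ σ K} (hM : MatReg A M) (x₀ : X) :
    ∃ u ∈ A, u x₀ ≠ 0 ∧ ∀ x, u x ≠ 0 →
      Module.finrank K (LinearMap.ker (M x).mulVecLin) ≤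
        Module.finrank K (LinearMap.ker (M x₀).mulVecLin) := by
  obtain ⟨D, hD, -, -, hD0, hle, -⟩ := exists_kernel_param hM x₀
  refine ⟨D, hD, hD0, fun x hx => ?_⟩
  have h1 := (M x).mulVecLin.finrank_range_add_finrank_ker
  have h2 := (M x₀).mulVecLin.finrank_range_add_finrank_ker
  have h3 : (M x₀).rank ≤ (M x).rank := hle x hx
  have h4 : (M x).rank = Module.finrank K (LinearMap.range (M x).mulVecLin) := rfl
  have h5 : (M x₀).rank = Module.finrank K (LinearMap.range (M x₀).mulVecLin) := rfl
  omega

end RegularFunctions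

/-! ## The matrices of `ε*_i` and `F_i` -/

section Matrices

variable {d : ℕ} {m : Fin d → ℕ} {k K : Type*} [Field K] {ν : Vertex m → ℕ}

instance (i j : Vertex m) : Subsingleton (i ⟶ j) := inferInstanceAs (Subsingleton (PLift _))

instance (i : Vertex m) : Fintype (Σ j : Vertex m, (i ⟶ j)) := Fintype.ofFinite _

/-- The matrix of `(f_τ)_{s(τ) = i}`. -/
def epsMat (i : Vertex m) (f : EC k K ν) :
    Matrix (Σ τ : (Σ j : Vertex m, (i ⟶ j)), Fin (ν τ.1)) (Fin (ν i)) K :=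
  fun a b => LinearMap.toMatrix' (f.1 a.1.2) a.2 b

theorem epsMat_mulVec_eq_zero_iff {i : Vertex m} {f : EC k K ν} {v : Fin (ν i) → K} :
    (epsMat i f).mulVec v = 0 ↔ ∀ (j : Vertex m) (τ : i ⟶ j), f.1 τ v = 0 := by
  have key : ∀ a, (epsMat i f).mulVec v a = f.1 a.1.2 v a.2 := fun a => by
    conv_rhs => rw [← Matrix.toLin'_toMatrix' (f.1 a.1.2), Matrix.toLin'_apply]
    rfl
  constructor
  · intro h j τ
    funext b
    exact (key ⟨⟨j, τ⟩, b⟩).symm.trans (congrFun h _)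
  · intro h
    funext a
    rw [key, h]
    rfl

/-- Writing `ε*_i` as the nullity of a matrix with regular entries makes the semicontinuity and the
kernel families available. -/
theorem epsStarPt_eq (i : Vertex m) (f : EC k K ν) :
    epsStarPt i f = Module.finrank K (LinearMap.ker (epsMat i f).mulVecLin) := by
  have : LinearMap.ker (LinearMap.pi (fun τ : (Σ j : Vertex m, (i ⟶ j)) => f.1 τ.2)) =
      LinearMap.ker (epsMat i f).mulVecLin := by
    ext v
    rw [LinearMap.mem_ker, LinearMap.mem_ker, Matrix.mulVecLin_apply, epsMat_mulVec_eq_zero_iff,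
      funext_iff]
    exact ⟨fun h j τ => h ⟨j, τ⟩, fun h τ => h τ.1 τ.2⟩
  rw [epsStarPt, this]

open Classical in
/-- The matrix of `F_i(f)`. -/
def fMat (i : Vertex m) (f : EC k K ν) :
    Matrix (Σ l : in2 i, Fin (ν l)) (Σ j : in1 i, Fin (ν j)) K :=
  fun a b => LinearMap.toMatrix' (FStarComp i f b.1 a.1) a.2 b.2

open Classical in
theorem fMat_mulVec (i : Vertex m) (f : EC k K ν) (w : (Σ j : in1 i, Fin (ν j)) → K)
    (a : Σ l : in2 i, Fin (ν l)) :
    (fMat i f).mulVec w a = FStar i f (fun j c => w ⟨j, c⟩) a.1 a.2 := by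
  simp only [Matrix.mulVec, dotProduct, FStar, LinearMap.pi_apply, LinearMap.sum_apply,
    LinearMap.comp_apply, LinearMap.proj_apply, Finset.sum_apply, Fintype.sum_sigma]
  refine Finset.sum_congr rfl fun j _ => ?_
  conv_rhs => rw [← Matrix.toLin'_toMatrix' (FStarComp i f j a.1), Matrix.toLin'_apply]
  rfl

open Classical in
theorem finrank_extStar_eq (i : Vertex m) (f : EC k K ν) :
    Module.finrank K (ExtStar i f) =
      Module.finrank K (LinearMap.ker (fMat i f).mulVecLin) := by
  rw [Subspace.dual_finrank_eq]
  have h : Submodule.comap (LinearEquiv.piCurry K (fun (j : in1 i) (_ : Fin (ν j)) => K) :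
      _ →ₗ[K] _) (LinearMap.ker (FStar i f)) = LinearMap.ker (fMat i f).mulVecLin := by
    ext w
    rw [Submodule.mem_comap, LinearMap.mem_ker, LinearMap.mem_ker, Matrix.mulVecLin_apply]
    constructor
    · intro h
      funext a
      rw [fMat_mulVec]
      exact congrFun (congrFun h a.1) a.2
    · intro h
      funext l c
      exact (fMat_mulVec i f w ⟨l, c⟩).symm.trans (congrFun h _)
  rw [← h]
  exact (LinearEquiv.finrank_eq (LinearEquiv.ofSubmodule' (LinearEquiv.piCurry K
    (fun (j : in1 i) (_ : Fin (ν j)) => K)) (LinearMap.ker (FStar i f)))).symm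

end Matrices

/-! ## Regular functions on the representation varieties -/

section RepresentationVariety

variable {d : ℕ} {m : Fin d → ℕ} {k K : Type*} [Field k] [Field K] [Algebra k K]
  {ν : Vertex m → ℕ}

variable (k K ν) in
/-- The ring of regular functions on `E_C(ν)`, with coefficients in `k`. -/
def regEC : Subalgebra k (EC k K ν → K) :=
  Algebra.adjoin k (Set.range fun (e : Entry ν) (f : EC k K ν) => Rep.entries f.1 e)

theorem mem_regEC_iff {a : EC k K ν → K} :
    a ∈ regEC k K ν ↔ ∃ p : MvPolynomial (Entry ν) k,
      ∀ f, a f = MvPolynomial.aeval (Rep.entries f.1) p := by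
  have key : ∀ (p : MvPolynomial (Entry ν) k) (f : EC k K ν),
      MvPolynomial.aeval (fun (e : Entry ν) (f : EC k K ν) => Rep.entries f.1 e) p f =
        MvPolynomial.aeval (Rep.entries f.1) p := by
    intro p f
    induction p using MvPolynomial.induction_on with
    | C c => simp
    | add p q hp hq => simp [hp, hq]
    | mul_X p e hp => simp [hp]
  rw [regEC, Algebra.adjoin_range_eq_range_aeval, AlgHom.mem_range]
  constructor
  · rintro ⟨p, rfl⟩
    exact ⟨p, key p⟩
  · rintro ⟨p, hp⟩
    exact ⟨p, funext fun f => by rw [key, hp]⟩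

theorem matReg_toMatrix {i j : Vertex m} (τ : i ⟶ j) :
    MatReg (regEC k K ν) fun f => LinearMap.toMatrix' (f.1 τ) :=
  fun a b => Algebra.subset_adjoin ⟨⟨⟨i, j, τ⟩, a, b⟩, rfl⟩

/-- This and the next two results replace the induced Zariski topology by vanishing of functions in
`regEC`; afterwards only functions are used. -/
theorem isClosed_iff {Z : Set (EC k K ν)} :
    IsClosed Z ↔ ∃ T ⊆ (regEC k K ν : Set (EC k K ν → K)), Z = {f | ∀ a ∈ T, a f = 0} := by
  let _ := zariskiTopology k K (Entry ν)
  have h0 : ∀ W : Set (Entry ν → K), IsClosed W ↔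
      W ∈ Set.range (MvPolynomial.zeroLocus (k := k) (σ := Entry ν) K) := by
    intro W
    rw [← isOpen_compl_iff]
    change Wᶜᶜ ∈ _ ↔ _
    rw [compl_compl]
  have h1 : IsClosed Z ↔ ∃ W : Set (Entry ν → K), IsClosed W ∧
      (fun f : EC k K ν => Rep.entries f.1) ⁻¹' W = Z := isClosed_induced_iff
  rw [h1]
  constructor
  · rintro ⟨W, hW, rfl⟩
    obtain ⟨I, rfl⟩ := (h0 W).1 hW
    refine ⟨{a | ∃ p ∈ I, ∀ f, a f = MvPolynomial.aeval (Rep.entries f.1) p}, ?_, ?_⟩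
    · rintro a ⟨p, -, hp⟩
      exact mem_regEC_iff.2 ⟨p, hp⟩
    · ext f
      simp only [Set.mem_preimage, MvPolynomial.mem_zeroLocus_iff, Set.mem_ofPred_eq]
      constructor
      · rintro h a ⟨p, hp, hpa⟩
        rw [hpa, h p hp]
      · exact fun h p hp => h (fun f => MvPolynomial.aeval (Rep.entries f.1) p)
          ⟨p, hp, fun _ => rfl⟩
  · rintro ⟨T, hT, rfl⟩
    refine ⟨MvPolynomial.zeroLocus K (Ideal.span {p : MvPolynomial (Entry ν) k |
      (fun f : EC k K ν => MvPolynomial.aeval (Rep.entries f.1) p) ∈ T}), (h0 _).2 ⟨_, rfl⟩, ?_⟩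
    ext f
    rw [MvPolynomial.zeroLocus_span]
    simp only [Set.mem_preimage, Set.mem_ofPred_eq]
    constructor
    · intro h a ha
      obtain ⟨p, hp⟩ := mem_regEC_iff.1 (hT ha)
      have : a = fun f : EC k K ν => MvPolynomial.aeval (Rep.entries f.1) p := funext hp
      rw [hp]
      exact h p (by rwa [this] at ha)
    · exact fun h p hp => h _ hp

theorem mem_closure_iff_regEC {S : Set (EC k K ν)} {f : EC k K ν} :
    f ∈ closure S ↔ ∀ a ∈ regEC k K ν, (∀ g ∈ S, a g = 0) → a f = 0 := by
  constructor
  · intro hf a ha h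
    have hc : IsClosed {g : EC k K ν | ∀ b ∈ ({a} : Set (EC k K ν → K)), b g = 0} :=
      isClosed_iff.2 ⟨{a}, Set.singleton_subset_iff.2 ha, rfl⟩
    exact closure_minimal (fun g hg b hb => by rw [hb]; exact h g hg) hc hf a rfl
  · intro h
    obtain ⟨T, hT, hS⟩ := isClosed_iff.1 (isClosed_closure (s := S))
    rw [hS]
    refine fun a ha => h a (hT ha) fun g hg => ?_
    have : g ∈ closure S := subset_closure hg
    rw [hS] at this
    exact this a ha

theorem isPreirreducible_iff_isPreirr {S : Set (EC k K ν)} :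
    IsPreirreducible S ↔ IsPreirr (regEC k K ν) S := by
  rw [isPreirreducible_iff_isClosed_union_isClosed]
  constructor
  · rintro h a ha b hb ⟨x, hx, hax⟩ ⟨y, hy, hby⟩
    by_contra hc
    push Not at hc
    rcases h {g | ∀ c ∈ ({a} : Set (EC k K ν → K)), c g = 0}
      {g | ∀ c ∈ ({b} : Set (EC k K ν → K)), c g = 0}
      (isClosed_iff.2 ⟨{a}, Set.singleton_subset_iff.2 ha, rfl⟩)
      (isClosed_iff.2 ⟨{b}, Set.singleton_subset_iff.2 hb, rfl⟩) (fun z hz => by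
        by_cases h0 : a z = 0
        · exact Or.inl fun c hc => by rw [hc, h0]
        · exact Or.inr fun c hc' => by rw [hc', hc z hz h0]) with h | h
    · exact hax (h hx a rfl)
    · exact hby (h hy b rfl)
  · intro h Z₁ Z₂ hZ₁ hZ₂ hS
    obtain ⟨T₁, hT₁, rfl⟩ := isClosed_iff.1 hZ₁
    obtain ⟨T₂, hT₂, rfl⟩ := isClosed_iff.1 hZ₂
    by_contra hc
    simp only [not_or, Set.not_subset, Set.mem_ofPred_eq, not_forall] at hc
    obtain ⟨⟨x, hx, a, ha, hax⟩, y, hy, b, hb, hby⟩ := hc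
    obtain ⟨z, hz, h1, h2⟩ := h a (hT₁ ha) b (hT₂ hb) ⟨x, hx, hax⟩ ⟨y, hy, hby⟩
    rcases hS hz with h | h
    · exact h1 (h a ha)
    · exact h2 (h b hb)

theorem isPreirr_of_mem_irreducibleComponents {Λ : Set (EC k K ν)}
    (hΛ : Λ ∈ irreducibleComponents (EC k K ν)) : IsPreirr (regEC k K ν) Λ :=
  isPreirreducible_iff_isPreirr.1 hΛ.1.2

theorem nonempty_of_mem_irreducibleComponents {Λ : Set (EC k K ν)}
    (hΛ : Λ ∈ irreducibleComponents (EC k K ν)) : Λ.Nonempty := hΛ.1.1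

/-- The closure of `S` is irreducible and contains the maximal irreducible set `Λ`. This reduces
equality with a component to a single inclusion. -/
theorem closure_eq_of_subset_closure {Λ S : Set (EC k K ν)}
    (hΛ : Λ ∈ irreducibleComponents (EC k K ν)) (hS : IsPreirr (regEC k K ν) S)
    (h : Λ ⊆ closure S) : closure S = Λ := by
  have hne : (closure S).Nonempty := hΛ.1.1.mono h
  have hirr : IsIrreducible (closure S) :=
    ⟨hne, (isPreirreducible_iff_isPreirr.2 hS).closure⟩
  exact (hΛ.2 hirr h).antisymm h

theorem subset_of_subset_of_isPreirr {Λ S : Set (EC k K ν)}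
    (hΛ : Λ ∈ irreducibleComponents (EC k K ν)) (hS : IsPreirr (regEC k K ν) S)
    (h : Λ ⊆ S) : S ⊆ Λ :=
  subset_closure.trans (closure_eq_of_subset_closure hΛ hS (h.trans subset_closure)).subset

/-! ### Semicontinuity -/

/-- `U` is a relatively open subset of `Λ` in the Zariski topology. -/
def IsRelOpen (U Λ : Set (EC k K ν)) : Prop :=
  U ⊆ Λ ∧ ∀ x ∈ U, ∃ u ∈ regEC k K ν, u x ≠ 0 ∧ ∀ y ∈ Λ, u y ≠ 0 → y ∈ U

theorem IsRelOpen.isPreirr {U Λ : Set (EC k K ν)} (h : IsRelOpen U Λ)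
    (hΛ : IsPreirr (regEC k K ν) Λ) : IsPreirr (regEC k K ν) U :=
  hΛ.of_locally_open h.1 h.2

theorem IsRelOpen.inter {U V Λ : Set (EC k K ν)} (hU : IsRelOpen U Λ) (hV : IsRelOpen V Λ) :
    IsRelOpen (U ∩ V) Λ := by
  refine ⟨fun x hx => hU.1 hx.1, fun x hx => ?_⟩
  obtain ⟨u, hu, hux, h⟩ := hU.2 x hx.1
  obtain ⟨v, hv, hvx, h'⟩ := hV.2 x hx.2
  refine ⟨u * v, Subalgebra.mul_mem _ hu hv, mul_ne_zero hux hvx, fun y hy hne => ?_⟩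
  rw [Pi.mul_apply] at hne
  exact ⟨h y hy (left_ne_zero_of_mul hne), h' y hy (right_ne_zero_of_mul hne)⟩

theorem IsRelOpen.inter_nonempty {U V Λ : Set (EC k K ν)} (hU : IsRelOpen U Λ)
    (hV : IsRelOpen V Λ) (hΛ : IsPreirr (regEC k K ν) Λ) (hU0 : U.Nonempty) (hV0 : V.Nonempty) :
    (U ∩ V).Nonempty := by
  obtain ⟨x, hx⟩ := hU0
  obtain ⟨y, hy⟩ := hV0
  obtain ⟨u, hu, hux, h⟩ := hU.2 x hx
  obtain ⟨v, hv, hvy, h'⟩ := hV.2 y hy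
  obtain ⟨z, hz, h1, h2⟩ := hΛ u hu v hv ⟨x, hU.1 hx, hux⟩ ⟨y, hV.1 hy, hvy⟩
  exact ⟨z, h z hz h1, h' z hz h2⟩

/-- A function vanishing on `U` but not on `Λ` would have a nonvanishing locus that is open in `Λ`
and disjoint from `U`. -/
theorem IsRelOpen.subset_closure {U Λ : Set (EC k K ν)} (hU : IsRelOpen U Λ)
    (hΛ : IsPreirr (regEC k K ν) Λ) (hU0 : U.Nonempty) : Λ ⊆ closure U := by
  intro y hy
  rw [mem_closure_iff_regEC]
  intro a ha h
  by_contra hay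
  obtain ⟨x, hx⟩ := hU0
  obtain ⟨u, hu, hux, hU'⟩ := hU.2 x hx
  obtain ⟨z, hz, h1, h2⟩ := hΛ u hu a ha ⟨x, hU.1 hx, hux⟩ ⟨y, hy, hay⟩
  exact h2 (h z (hU' z hz h1))

/-- Upper semicontinuity: the sublevel sets of the function are open. -/
def IsUSC (g : EC k K ν → ℕ) : Prop :=
  ∀ x, ∃ u ∈ regEC k K ν, u x ≠ 0 ∧ ∀ y, u y ≠ 0 → g y ≤ g x

theorem IsUSC.isRelOpen_minLocus {g : EC k K ν → ℕ} (hg : IsUSC g) (Λ : Set (EC k K ν)) :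
    IsRelOpen (minLocus g Λ) Λ := by
  refine ⟨fun x hx => hx.1, fun x hx => ?_⟩
  obtain ⟨u, hu, hux, h⟩ := hg x
  exact ⟨u, hu, hux, fun y hy hy0 => ⟨hy, fun z hz => (h y hy0).trans (hx.2 z hz)⟩⟩

theorem minLocus_nonempty {X : Type*} (g : X → ℕ) {Λ : Set X} (h : Λ.Nonempty) :
    (minLocus g Λ).Nonempty := by
  obtain ⟨x, hx, hm⟩ := exists_minimalFor_of_wellFoundedLT (· ∈ Λ) g h
  exact ⟨x, hx, fun y hy => (le_total (g x) (g y)).elim id (hm hy)⟩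

theorem sInf_image_eq_of_mem_minLocus {X : Type*} {g : X → ℕ} {Λ : Set X} {x : X}
    (h : x ∈ minLocus g Λ) : sInf (g '' Λ) = g x := by
  refine le_antisymm (Nat.sInf_le ⟨x, h.1, rfl⟩) (le_csInf ⟨_, x, h.1, rfl⟩ ?_)
  rintro _ ⟨y, hy, rfl⟩
  exact h.2 y hy

/-- The minimum of an upper semicontinuous function on the closure of a set on which the function
is constant. -/
theorem IsUSC.sInf_image_closure {g : EC k K ν → ℕ} (hg : IsUSC g) {S : Set (EC k K ν)} {c : ℕ}
    (hc : ∀ x ∈ S, c ≤ g x) {x : EC k K ν} (hx : x ∈ S) (hxc : g x = c) :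
    sInf (g '' closure S) = c := by
  rw [← hxc]
  refine sInf_image_eq_of_mem_minLocus ⟨_root_.subset_closure hx, fun y hy => ?_⟩
  obtain ⟨u, hu, huy, h⟩ := hg y
  by_contra hlt
  rw [mem_closure_iff_regEC] at hy
  refine huy (hy u hu fun z hz => ?_)
  by_contra hz0
  exact hlt (hxc.le.trans ((hc z hz).trans (h z hz0)))

theorem mem_minLocus_iff_eq {X : Type*} {g : X → ℕ} {Λ : Set X} {x y : X}
    (h : x ∈ minLocus g Λ) : y ∈ minLocus g Λ ↔ y ∈ Λ ∧ g y = g x :=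
  ⟨fun hy => ⟨hy.1, (hy.2 x h.1).antisymm (h.2 y hy.1)⟩,
    fun hy => ⟨hy.1, fun z hz => hy.2.le.trans (h.2 z hz)⟩⟩

theorem matReg_epsMat (i : Vertex m) : MatReg (regEC k K ν) (epsMat i) :=
  fun a b => matReg_toMatrix a.1.2 a.2 b

theorem isUSC_epsStarPt (i : Vertex m) : IsUSC (epsStarPt (k := k) (K := K) (ν := ν) i) := by
  intro x
  simp only [epsStarPt_eq]
  exact exists_mem_finrank_ker_le (matReg_epsMat i) x

theorem matReg_fMat (i : Vertex m) : MatReg (regEC k K ν) (fMat i) := by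
  intro a b
  simp only [fMat, FStarComp, transposeMap]
  split_ifs with h1 h2
  · simp only [LinearMap.toMatrix'_toLin', Matrix.transpose_apply]
    exact matReg_toMatrix _ _ _
  · simp only [map_neg, LinearMap.toMatrix'_toLin', Matrix.neg_apply, Matrix.transpose_apply]
    exact Subalgebra.neg_mem _ (matReg_toMatrix _ _ _)
  · simp only [map_zero, Matrix.zero_apply]
    exact Subalgebra.zero_mem _

theorem isUSC_finrank_extStar (i : Vertex m) :
    IsUSC (fun f : EC k K ν => Module.finrank K (ExtStar i f)) := by
  classical
  intro x
  simp only [finrank_extStar_eq]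
  exact exists_mem_finrank_ker_le (matReg_fMat i) x

end RepresentationVariety

/-! ## Change of bases -/

section Conj

variable {d : ℕ} {m : Fin d → ℕ} {k K : Type*} [Field K] {ν : Vertex m → ℕ}

theorem mulVec_injective_of_det_ne_zero {σ : Type*} [Fintype σ] [DecidableEq σ]
    {h : Matrix σ σ K} (hh : h.det ≠ 0) : Function.Injective (Matrix.toLin' h) := by
  have := Matrix.mulVec_injective_of_isUnit
    ((Matrix.isUnit_iff_isUnit_det _).2 (isUnit_iff_ne_zero.2 hh))
  exact this

theorem det_toMatrix_ne_zero {n : ℕ} {g : (Fin n → K) →ₗ[K] (Fin n → K)}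
    (hg : Function.Injective g) : (LinearMap.toMatrix' g).det ≠ 0 := by
  rw [LinearMap.det_toMatrix']
  exact (LinearMap.isUnit_det g ((Module.End.isUnit_iff g).2
    ⟨hg, LinearMap.injective_iff_surjective.1 hg⟩)).ne_zero

/-- The representation in the new bases given by the columns of the matrices `h j`. -/
def Rep.conj (h : ∀ j, Matrix (Fin (ν j)) (Fin (ν j)) K) (f : Rep K ν) : Rep K ν :=
  fun i j τ => Matrix.toLin' ((h j)⁻¹ * LinearMap.toMatrix' (f τ) * h i)

theorem Rep.conj_comp {h : ∀ j, Matrix (Fin (ν j)) (Fin (ν j)) K} (hh : ∀ j, (h j).det ≠ 0)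
    (f : Rep K ν) {i j : Vertex m} (τ : i ⟶ j) :
    Matrix.toLin' (h j) ∘ₗ f.conj h τ = f τ ∘ₗ Matrix.toLin' (h i) := by
  rw [Rep.conj, ← Matrix.toLin'_mul, ← Matrix.mul_assoc, ← Matrix.mul_assoc,
    Matrix.mul_nonsing_inv _ (isUnit_iff_ne_zero.2 (hh j)), Matrix.one_mul, Matrix.toLin'_mul,
    Matrix.toLin'_toMatrix']

theorem Rep.conj_eval {h : ∀ j, Matrix (Fin (ν j)) (Fin (ν j)) K} (hh : ∀ j, (h j).det ≠ 0)
    (f : Rep K ν) {i j : Vertex m} (p : Quiver.Path i j) :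
    Matrix.toLin' (h j) ∘ₗ (f.conj h).eval p = f.eval p ∘ₗ Matrix.toLin' (h i) := by
  induction p with
  | nil => rfl
  | cons p τ ih =>
    simp only [Rep.eval]
    rw [← LinearMap.comp_assoc, Rep.conj_comp hh, LinearMap.comp_assoc, ih, LinearMap.comp_assoc]

theorem Rep.Commutes.conj {h : ∀ j, Matrix (Fin (ν j)) (Fin (ν j)) K}
    (hh : ∀ j, (h j).det ≠ 0) {f : Rep K ν} (hf : f.Commutes) : (f.conj h).Commutes := by
  intro i j p q
  rw [← LinearMap.cancel_left (mulVec_injective_of_det_ne_zero (hh j)), Rep.conj_eval hh,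
    Rep.conj_eval hh, hf i j p q]

theorem Rep.conj_one (f : Rep K ν) : f.conj (fun _ => 1) = f := by
  funext i j τ
  simp [Rep.conj]

theorem Rep.conj_conj_inv {h : ∀ j, Matrix (Fin (ν j)) (Fin (ν j)) K}
    (hh : ∀ j, (h j).det ≠ 0) (f : Rep K ν) : (f.conj h).conj (fun j => (h j)⁻¹) = f := by
  funext i j τ
  have h1 := Matrix.mul_nonsing_inv _ (isUnit_iff_ne_zero.2 (hh j))
  have h2 := Matrix.mul_nonsing_inv _ (isUnit_iff_ne_zero.2 (hh i))
  simp only [Rep.conj, LinearMap.toMatrix'_toLin']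
  rw [Matrix.nonsing_inv_nonsing_inv _ (isUnit_iff_ne_zero.2 (hh j)), ← Matrix.mul_assoc,
    ← Matrix.mul_assoc, h1, Matrix.one_mul, Matrix.mul_assoc, h2, Matrix.mul_one,
    Matrix.toLin'_toMatrix']

open Classical in
/-- A point of `E_C(ν)` in new bases (and the point itself if the matrices are singular). -/
def conjEC (h : ∀ j, Matrix (Fin (ν j)) (Fin (ν j)) K) (f : EC k K ν) : EC k K ν :=
  if hh : ∀ j, (h j).det ≠ 0 then ⟨f.1.conj h, f.2.conj hh⟩ else f

theorem conjEC_val {h : ∀ j, Matrix (Fin (ν j)) (Fin (ν j)) K} (hh : ∀ j, (h j).det ≠ 0)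
    (f : EC k K ν) : (conjEC h f).1 = f.1.conj h :=
  congrArg (fun g : EC k K ν => g.1) (dif_pos hh)

theorem conjEC_one (f : EC k K ν) : conjEC (fun _ => 1) f = f :=
  Subtype.ext (by rw [conjEC_val (by simp), Rep.conj_one])

theorem det_inv_ne_zero {h : ∀ j, Matrix (Fin (ν j)) (Fin (ν j)) K} (hh : ∀ j, (h j).det ≠ 0)
    (j : Vertex m) : ((h j)⁻¹).det ≠ 0 := by
  rw [Matrix.det_nonsing_inv, Ring.inverse_eq_inv']
  exact inv_ne_zero (hh j)

theorem conjEC_conjEC_inv {h : ∀ j, Matrix (Fin (ν j)) (Fin (ν j)) K}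
    (hh : ∀ j, (h j).det ≠ 0) (f : EC k K ν) :
    conjEC (fun j => (h j)⁻¹) (conjEC h f) = f :=
  Subtype.ext (by rw [conjEC_val (det_inv_ne_zero hh), conjEC_val hh, Rep.conj_conj_inv hh])

theorem conj_apply_eq_zero_iff {h : ∀ j, Matrix (Fin (ν j)) (Fin (ν j)) K}
    (hh : ∀ j, (h j).det ≠ 0) {f : Rep K ν} {i j : Vertex m} (τ : i ⟶ j) (v : Fin (ν i) → K) :
    f.conj h τ v = 0 ↔ f τ ((h i).mulVec v) = 0 := by
  have h1 := LinearMap.congr_fun (Rep.conj_comp hh f τ) v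
  simp only [LinearMap.comp_apply, Matrix.toLin'_apply (h i)] at h1
  rw [← h1, map_eq_zero_iff _ (mulVec_injective_of_det_ne_zero (hh j))]

theorem epsStarPt_conjEC {h : ∀ j, Matrix (Fin (ν j)) (Fin (ν j)) K}
    (hh : ∀ j, (h j).det ≠ 0) (i : Vertex m) (f : EC k K ν) :
    epsStarPt i (conjEC h f) = epsStarPt i f := by
  let e : (Fin (ν i) → K) ≃ₗ[K] (Fin (ν i) → K) :=
    LinearEquiv.ofInjectiveEndo _ (mulVec_injective_of_det_ne_zero (hh i))
  have : LinearMap.ker (LinearMap.pi (fun τ : (Σ j : Vertex m, (i ⟶ j)) => (conjEC h f).1 τ.2)) =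
      Submodule.comap (e : _ →ₗ[K] _)
        (LinearMap.ker (LinearMap.pi (fun τ : (Σ j : Vertex m, (i ⟶ j)) => f.1 τ.2))) := by
    ext v
    rw [Submodule.mem_comap, LinearMap.mem_ker, LinearMap.mem_ker, funext_iff, funext_iff]
    refine forall_congr' fun τ => ?_
    simp only [LinearMap.pi_apply, conjEC_val hh]
    exact conj_apply_eq_zero_iff hh τ.2 v
  rw [epsStarPt, this]
  exact LinearEquiv.finrank_eq (LinearEquiv.ofSubmodule' e _)

/-- Families of square matrices, one for every vertex, from their entries. -/
def toMatrices (w : (Σ j : Vertex m, Fin (ν j) × Fin (ν j)) → K) (j : Vertex m) :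
    Matrix (Fin (ν j)) (Fin (ν j)) K := fun a c => w ⟨j, a, c⟩

variable (S : Set (EC k K ν)) in
/-- The union of the orbits of the points of a set. -/
def orbits : Set (EC k K ν) := {g | ∃ f ∈ S, ∃ h, (∀ j, (h j).det ≠ 0) ∧ conjEC h f = g}

variable (S : Set (EC k K ν)) in
/-- Pairs of a point of a set and invertible matrices. -/
def orbitParam : Set (EC k K ν × ((Σ j : Vertex m, Fin (ν j) × Fin (ν j)) → K)) :=
  {p | p.1 ∈ S ∧ ∀ j, (toMatrices p.2 j).det ≠ 0}

theorem subset_orbits (S : Set (EC k K ν)) : S ⊆ orbits S :=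
  fun f hf => ⟨f, hf, fun _ => 1, by simp, conjEC_one f⟩

theorem orbits_eq_image (S : Set (EC k K ν)) :
    orbits S = (fun p => conjEC (toMatrices p.2) p.1) '' orbitParam S := by
  ext g
  constructor
  · rintro ⟨f, hf, h, hh, rfl⟩
    exact ⟨(f, fun e => h e.1 e.2.1 e.2.2), ⟨hf, hh⟩, rfl⟩
  · rintro ⟨⟨f, w⟩, ⟨hf, hh⟩, rfl⟩
    exact ⟨f, hf, toMatrices w, hh, rfl⟩

end Conj

/-! ### Irreducibility and density under changes of bases -/

section Orbits

variable {d : ℕ} {m : Fin d → ℕ} {k K : Type*} [Field k] [Field K] [Algebra k K]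
  {ν : Vertex m → ℕ} {X : Type*}

/-- Membership depends only on the values on `S`. Maps defined by cases, such as `conjEC` and
`extEC`, can thus be replaced by the formula valid on `S`. -/
theorem ratOn_congr {A : Subalgebra k (X → K)} {S : Set X} {g g' : X → K} (hg : g ∈ ratOn A S)
    (h : ∀ x ∈ S, g' x = g x) : g' ∈ ratOn A S := by
  obtain ⟨u, hu, a, ha, h'⟩ := hg
  exact ⟨u, hu, a, ha, fun x hx => by rw [h x hx]; exact h' x hx⟩

theorem regEC_comp_mem {C : Subalgebra k (X → K)} {φ : X → EC k K ν}
    (h : ∀ (i j : Vertex m) (τ : i ⟶ j), MatReg C fun x => LinearMap.toMatrix' ((φ x).1 τ))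
    {b : EC k K ν → K} (hb : b ∈ regEC k K ν) : b ∘ φ ∈ C := by
  induction hb using Algebra.adjoin_induction with
  | mem g hg =>
    obtain ⟨e, rfl⟩ := hg
    exact h _ _ e.1.2.2 e.2.1 e.2.2
  | algebraMap c => exact C.algebraMap_mem c
  | add g g' _ _ h h' => exact C.add_mem h h'
  | mul g g' _ _ h h' => exact C.mul_mem h h'

theorem matReg_comp {C : Subalgebra k (X → K)} {φ : X → EC k K ν}
    (h : ∀ b ∈ regEC k K ν, b ∘ φ ∈ C) {i j : Vertex m} (τ : i ⟶ j) :
    MatReg C fun x => LinearMap.toMatrix' ((φ x).1 τ) :=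
  fun a c => h _ (matReg_toMatrix τ a c)

/-- The only denominators come from inverting the matrices, and these determinants do not vanish on
`S`. -/
theorem conjEC_comp_mem {A : Subalgebra k (X → K)} {S : Set X} {φ : X → EC k K ν}
    (hφ : ∀ b ∈ regEC k K ν, b ∘ φ ∈ A) {H : X → ∀ j, Matrix (Fin (ν j)) (Fin (ν j)) K}
    (hH : ∀ j, MatReg A fun x => H x j) (hdet : ∀ x ∈ S, ∀ j, (H x j).det ≠ 0)
    {b : EC k K ν → K} (hb : b ∈ regEC k K ν) :
    (b ∘ fun x => conjEC (H x) (φ x)) ∈ ratOn A S := by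
  refine regEC_comp_mem (fun i j τ a c => ?_) hb
  have hH' : ∀ j, MatReg (ratOn A S) fun x => H x j := fun j a c => le_ratOn (hH j a c)
  have h1 : MatReg (ratOn A S) fun x => (H x j)⁻¹ :=
    (hH' j).inv_ratOn fun x hx => hdet x hx j
  have h2 : MatReg (ratOn A S) fun x => LinearMap.toMatrix' ((φ x).1 τ) :=
    fun a c => le_ratOn (matReg_comp hφ τ a c)
  refine ratOn_congr (((h1.mul h2).mul (hH' i)) a c) fun x hx => ?_
  refine (congrArg (fun g : Rep K ν => LinearMap.toMatrix' (g τ) a c)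
    (conjEC_val (hdet x hx) (φ x))).trans ?_
  simp only [Rep.conj, LinearMap.toMatrix'_toLin']

theorem conjEC_comp_mem_ratOn_orbitParam (S : Set (EC k K ν)) {b : EC k K ν → K}
    (hb : b ∈ regEC k K ν) :
    (b ∘ fun p : EC k K ν × ((Σ j : Vertex m, Fin (ν j) × Fin (ν j)) → K) =>
      conjEC (toMatrices p.2) p.1) ∈ ratOn (polyExt (regEC k K ν) _) (orbitParam S) :=
  conjEC_comp_mem (fun _ hb => fst_mem_polyExt hb) (fun _ _ _ => coord_mem_polyExt _)
    (fun _ hp => hp.2) hb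

variable [Infinite K] {S : Set (EC k K ν)}

/-- Invertibility at all vertices is nonvanishing of one product of determinants, hence an open
condition on the product of `S` with an affine space. -/
theorem IsPreirr.orbitParam (hS : IsPreirr (regEC k K ν) S) :
    IsPreirr (polyExt (regEC k K ν) _) (orbitParam S) := by
  refine (hS.prod).of_locally_open (fun p hp => hp.1) fun p hp =>
    ⟨fun p => ∏ j, (toMatrices p.2 j).det, ?_, Finset.prod_ne_zero_iff.2 fun j _ => hp.2 j,
      fun q hq h => ⟨hq, fun j => Finset.prod_ne_zero_iff.1 h j (Finset.mem_univ j)⟩⟩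
  have : (fun p : EC k K ν × ((Σ j : Vertex m, Fin (ν j) × Fin (ν j)) → K) =>
      ∏ j, (toMatrices p.2 j).det) = ∏ j, fun p => (toMatrices p.2 j).det := by
    funext p
    simp
  rw [this]
  exact Subalgebra.prod_mem _ fun j _ => MatReg.det fun a c => coord_mem_polyExt _

theorem IsPreirr.orbits (hS : IsPreirr (regEC k K ν) S) :
    IsPreirr (regEC k K ν) (orbits S) := by
  rw [orbits_eq_image]
  exact hS.orbitParam.image _ fun b hb => conjEC_comp_mem_ratOn_orbitParam S hb

/-- The union of the orbits of `Λ` is irreducible and contains `Λ`, so maximality leaves no room for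
new points. -/
theorem conjEC_mem_component {Λ : Set (EC k K ν)}
    (hΛ : Λ ∈ irreducibleComponents (EC k K ν)) {f : EC k K ν} (hf : f ∈ Λ)
    {h : ∀ j, Matrix (Fin (ν j)) (Fin (ν j)) K} (hh : ∀ j, (h j).det ≠ 0) :
    conjEC h f ∈ Λ :=
  subset_of_subset_of_isPreirr hΛ (isPreirr_of_mem_irreducibleComponents hΛ).orbits
    (subset_orbits Λ) ⟨f, hf, h, hh, rfl⟩

theorem conjEC_mem_locus4 {Λ : Set (EC k K ν)} (hΛ : Λ ∈ irreducibleComponents (EC k K ν))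
    {i : Vertex m} {f : EC k K ν} (hf : f ∈ locus4 i Λ)
    {h : ∀ j, Matrix (Fin (ν j)) (Fin (ν j)) K} (hh : ∀ j, (h j).det ≠ 0) :
    conjEC h f ∈ locus4 i Λ :=
  (mem_minLocus_iff_eq hf).2 ⟨conjEC_mem_component hΛ hf.1 hh, epsStarPt_conjEC hh i f⟩

/-- In the irreducible space of pairs (point, bases), having the point in `W` is a nonempty open
condition. Neither `S` nor `W` need be stable under changes of bases. -/
theorem orbits_subset_closure {W : Set (EC k K ν)} (hS : IsPreirr (regEC k K ν) S)
    (hW : IsRelOpen W S) (hW0 : W.Nonempty) : orbits S ⊆ closure (orbits W) := by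
  rintro _ ⟨f, hf, h, hh, rfl⟩
  rw [mem_closure_iff_regEC]
  intro a ha hvan
  by_contra hne
  obtain ⟨x, hx⟩ := hW0
  obtain ⟨u, hu, hux, huW⟩ := hW.2 x hx
  obtain ⟨p, hp, h1, h2⟩ := hS.orbitParam.ratOn _ (le_ratOn (fst_mem_polyExt hu)) _
    (conjEC_comp_mem_ratOn_orbitParam S ha)
    ⟨(x, fun e => (1 : Matrix (Fin (ν e.1)) (Fin (ν e.1)) K) e.2.1 e.2.2),
      ⟨hW.1 hx, fun j => (by simp : (1 : Matrix (Fin (ν j)) (Fin (ν j)) K).det ≠ 0)⟩, hux⟩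
    ⟨(f, fun e => h e.1 e.2.1 e.2.2), ⟨hf, hh⟩, hne⟩
  exact h2 (hvan _ ⟨p.1, huW _ hp.1 h1, _, hp.2, rfl⟩)

end Orbits

/-! ## Squares and paths in the grid -/

section GridPaths

variable {d : ℕ} {m : Fin d → ℕ}

theorem IsArrow.exists_eq_add {i j : Vertex m} (h : IsArrow i j) :
    ∃ x, ∀ t, (j t : ℕ) = i t + if t = x then 1 else 0 := by
  obtain ⟨x, hx, h⟩ := h
  refine ⟨x, fun t => ?_⟩
  split_ifs with ht
  · rw [ht, hx]
  · rw [h t ht, add_zero]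

theorem IsArrow.of_eq_add {i j : Vertex m} {x : Fin d}
    (h : ∀ t, (j t : ℕ) = i t + if t = x then 1 else 0) : IsArrow i j := by
  refine ⟨x, ?_, fun t ht => Fin.ext ?_⟩
  · have := h x
    rw [if_pos rfl] at this
    exact this.symm
  · have := h t
    rw [if_neg ht, add_zero] at this
    exact this.symm

theorem IsArrow.ne {i j : Vertex m} (h : IsArrow i j) : i ≠ j := by
  rintro rfl
  obtain ⟨x, hx, -⟩ := h
  omega

theorem vertex_ext {i j : Vertex m} (h : ∀ t, (i t : ℕ) = j t) : i = j :=
  funext fun t => Fin.ext (h t)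

theorem le_of_path {i j : Vertex m} (p : Quiver.Path i j) (t : Fin d) : (i t : ℕ) ≤ j t := by
  induction p with
  | nil => exact le_rfl
  | cons p τ ih =>
    obtain ⟨x, hx⟩ := τ.down.exists_eq_add
    have := hx t
    omega

theorem isEmpty_path_of_arrow {i j : Vertex m} (h : IsArrow j i) (p : Quiver.Path i j) : False := by
  obtain ⟨x, hx⟩ := h.exists_eq_add
  have h1 := hx x
  have h2 := le_of_path p x
  rw [if_pos rfl] at h1
  omega

theorem nonempty_path_of_le {i j : Vertex m} (h : ∀ t, (i t : ℕ) ≤ j t) :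
    Nonempty (Quiver.Path i j) := by
  obtain ⟨n, hn⟩ : ∃ n, ∑ t, ((j t : ℕ) - i t) = n := ⟨_, rfl⟩
  induction n generalizing j with
  | zero =>
    have : i = j := vertex_ext fun t => by
      have h1 := Finset.sum_eq_zero_iff.1 hn t (Finset.mem_univ t)
      have := h t
      omega
    subst this
    exact ⟨.nil⟩
  | succ n ih =>
    obtain ⟨x, hx⟩ : ∃ x, (i x : ℕ) < j x := by
      by_contra hc
      push Not at hc
      rw [Finset.sum_eq_zero fun t _ => Nat.sub_eq_zero_of_le (hc t)] at hn
      omega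
    -- Lowering the target in a coordinate where it exceeds `i` supplies the last arrow of the path.
    let l : Vertex m := fun t => if t = x then ⟨j t - 1, by have := (j t).2; omega⟩ else j t
    have hl : ∀ t, (l t : ℕ) = if t = x then (j t : ℕ) - 1 else j t := by
      intro t
      simp only [l]
      split_ifs <;> rfl
    have harr : IsArrow l j := IsArrow.of_eq_add (x := x) fun t => by
      rw [hl]
      split_ifs with ht
      · subst ht
        omega
      · rfl
    obtain ⟨p⟩ := ih (j := l) (fun t => by
      rw [hl]
      have := h t
      split_ifs with ht
      · subst ht
        omega
      · exact this) (by
      have h1 : ∀ t, ((j t : ℕ) - i t) = ((l t : ℕ) - i t) + if t = x then 1 else 0 := by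
        intro t
        rw [hl]
        split_ifs with ht
        · subst ht
          omega
        · rfl
      rw [Finset.sum_congr rfl fun t _ => h1 t, Finset.sum_add_distrib] at hn
      simp only [Finset.sum_ite_eq', Finset.mem_univ, if_true] at hn
      omega)
    exact ⟨p.cons ⟨harr⟩⟩

/-- Two distinct predecessors of `i` are completed to a square below `i`. -/
theorem exists_square {i j j' : Vertex m} (hj : IsArrow j i) (hj' : IsArrow j' i) (hne : j ≠ j') :
    ∃ l, IsArrow l j ∧ IsArrow l j' ∧ ∀ t, (l t : ℕ) = min (j t : ℕ) (j' t) := by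
  obtain ⟨x, hx⟩ := hj.exists_eq_add
  obtain ⟨y, hy⟩ := hj'.exists_eq_add
  have hxy : x ≠ y := by
    rintro rfl
    refine hne (vertex_ext fun t => ?_)
    have h1 := hx t
    have h2 := hy t
    omega
  let l : Vertex m := fun t => ⟨min (j t : ℕ) (j' t), by have := (j t).2; omega⟩
  refine ⟨l, IsArrow.of_eq_add (x := y) fun t => ?_, IsArrow.of_eq_add (x := x) fun t => ?_,
    fun t => rfl⟩ <;>
  · have h1 := hx t
    have h2 := hy t
    have h3 : (l t : ℕ) = min (j t : ℕ) (j' t) := rfl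
    rw [h3]
    by_cases h : t = x
    · have h' : t ≠ y := fun h' => hxy (h.symm.trans h')
      simp only [if_pos h, if_neg h'] at h1 h2 ⊢
      omega
    · by_cases h' : t = y
      · simp only [if_neg h, if_pos h'] at h1 h2 ⊢
        omega
      · simp only [if_neg h, if_neg h'] at h1 h2 ⊢
        omega

/-- A square below `i` has only two vertices adjacent to `i`. -/
theorem eq_or_eq_of_square {i l j₁ j₂ j : Vertex m} (h₁ : IsArrow j₁ i) (h₂ : IsArrow j₂ i)
    (hne : j₁ ≠ j₂) (hl₁ : IsArrow l j₁) (hl₂ : IsArrow l j₂) (h : IsArrow j i)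
    (hl : IsArrow l j) : j = j₁ ∨ j = j₂ := by
  obtain ⟨a, ha⟩ := h₁.exists_eq_add
  obtain ⟨c, hc⟩ := h₂.exists_eq_add
  obtain ⟨a', ha'⟩ := hl₁.exists_eq_add
  obtain ⟨c', hc'⟩ := hl₂.exists_eq_add
  obtain ⟨x, hx⟩ := h.exists_eq_add
  obtain ⟨y, hy⟩ := hl.exists_eq_add
  have hac : a ≠ c := by
    rintro rfl
    refine hne (vertex_ext fun t => ?_)
    have h1 := ha t
    have h2 := hc t
    omega
  -- The vertex `l` lies one below `i` in both directions `a` and `c`. If the step from `j` to `i`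
  -- used neither, the single step from `l` to `j` would have to use both.
  have h1 : a = x ∨ c = x := by
    by_contra hcon
    push Not at hcon
    obtain ⟨hax, hcx⟩ := hcon
    have e1 := ha a
    have e2 := hc a
    have e3 := ha' a
    have e4 := hc' a
    have e5 := hx a
    have e6 := hy a
    have f1 := ha c
    have f2 := hc c
    have f3 := ha' c
    have f4 := hc' c
    have f5 := hx c
    have f6 := hy c
    rw [if_pos rfl] at e1 f2
    rw [if_neg hac] at e2
    rw [if_neg hac.symm] at f1
    rw [if_neg hax] at e5
    rw [if_neg hcx] at f5
    have g1 : a = y := by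
      by_contra h0
      rw [if_neg h0] at e6
      split_ifs at e3 e4 <;> omega
    have g2 : c = y := by
      by_contra h0
      rw [if_neg h0] at f6
      split_ifs at f3 f4 <;> omega
    exact hac (g1.trans g2.symm)
  rcases h1 with rfl | rfl
  · left
    refine vertex_ext fun t => ?_
    have h1 := hx t
    have h2 := ha t
    omega
  · right
    refine vertex_ext fun t => ?_
    have h1 := hx t
    have h2 := hc t
    omega

end GridPaths

/-! ## Representations with a one-dimensional subrepresentation spanned by a basis vector -/

section Standard

variable {d : ℕ} {m : Fin d → ℕ} {k K : Type*} [Field K] {b : Vertex m → ℕ} (i : Vertex m)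

/-- The projection to the first coordinates. -/
def stdQuot (j : Vertex m) : (Fin ((b + simpleDim i) j) → K) →ₗ[K] (Fin (b j) → K) :=
  LinearMap.funLeft K K (Fin.castAdd (simpleDim i j))

/-- The projection to the last coordinates. -/
def stdPart (j : Vertex m) : (Fin ((b + simpleDim i) j) → K) →ₗ[K] (Fin (simpleDim i j) → K) :=
  LinearMap.funLeft K K (Fin.natAdd (b j))

/-- The inclusion of the first coordinates. -/
def stdSec (j : Vertex m) : (Fin (b j) → K) →ₗ[K] (Fin ((b + simpleDim i) j) → K) where
  toFun v := Fin.append v 0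
  map_add' v w := by
    funext a
    refine Fin.addCases (fun c => ?_) (fun c => ?_) a <;> simp
  map_smul' r v := by
    funext a
    refine Fin.addCases (fun c => ?_) (fun c => ?_) a <;> simp

/-- The inclusion of the last coordinates. -/
def stdSub (j : Vertex m) : (Fin (simpleDim i j) → K) →ₗ[K] (Fin ((b + simpleDim i) j) → K) where
  toFun v := Fin.append 0 v
  map_add' v w := by
    funext a
    refine Fin.addCases (fun c => ?_) (fun c => ?_) a <;> simp
  map_smul' r v := by
    funext a
    refine Fin.addCases (fun c => ?_) (fun c => ?_) a <;> simp

variable {i}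

@[simp] theorem stdQuot_stdSec (j : Vertex m) (v : Fin (b j) → K) :
    stdQuot i j (stdSec i j v) = v :=
  funext fun a => Fin.append_left v (0 : Fin (simpleDim i j) → K) a

@[simp] theorem stdQuot_stdSub (j : Vertex m) (v : Fin (simpleDim i j) → K) :
    stdQuot (b := b) i j (stdSub i j v) = 0 :=
  funext fun a => Fin.append_left (0 : Fin (b j) → K) v a

@[simp] theorem stdPart_stdSub (j : Vertex m) (v : Fin (simpleDim i j) → K) :
    stdPart (b := b) i j (stdSub i j v) = v :=
  funext fun a => Fin.append_right (0 : Fin (b j) → K) v a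

@[simp] theorem stdPart_stdSec (j : Vertex m) (v : Fin (b j) → K) :
    stdPart i j (stdSec i j v) = 0 :=
  funext fun a => Fin.append_right v (0 : Fin (simpleDim i j) → K) a

theorem std_decomp (j : Vertex m) (v : Fin ((b + simpleDim i) j) → K) :
    v = stdSec i j (stdQuot i j v) + stdSub i j (stdPart i j v) := by
  funext a
  refine Fin.addCases (fun c => ?_) (fun c => ?_) a
  · have h : stdQuot i j v =
        stdQuot i j (stdSec i j (stdQuot i j v) + stdSub i j (stdPart i j v)) := by
      simp only [map_add, stdQuot_stdSec, stdQuot_stdSub, add_zero]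
    exact congrFun h c
  · have h : stdPart i j v =
        stdPart i j (stdSec i j (stdQuot i j v) + stdSub i j (stdPart i j v)) := by
      simp only [map_add, stdPart_stdSec, stdPart_stdSub, zero_add]
    exact congrFun h c

theorem stdQuot_surjective (j : Vertex m) : Function.Surjective (stdQuot (K := K) (b := b) i j) :=
  fun v => ⟨stdSec i j v, stdQuot_stdSec j v⟩

theorem stdSub_injective (j : Vertex m) : Function.Injective (stdSub (K := K) (b := b) i j) :=
  Function.LeftInverse.injective (stdPart_stdSub (b := b) j)

theorem stdSub_stdQuot_exact (j : Vertex m) :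
    Function.Exact (stdSub (K := K) (b := b) i j) (stdQuot i j) := by
  intro v
  constructor
  · intro h
    refine ⟨stdPart i j v, ?_⟩
    conv_rhs => rw [std_decomp j v, h, map_zero, zero_add]
  · rintro ⟨w, rfl⟩
    exact stdQuot_stdSub j w

theorem stdPart_eq_zero {j : Vertex m} (h : j ≠ i) (v : Fin ((b + simpleDim i) j) → K) :
    stdPart i j v = 0 := by
  funext c
  have h1 := c.2
  have h2 : simpleDim i j = 0 := Pi.single_eq_of_ne h 1
  omega

theorem stdSec_stdQuot {j : Vertex m} (h : j ≠ i) (v : Fin ((b + simpleDim i) j) → K) :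
    stdSec i j (stdQuot i j v) = v := by
  conv_rhs => rw [std_decomp j v, stdPart_eq_zero h, map_zero, add_zero]

theorem stdQuot_injective {j : Vertex m} (h : j ≠ i) :
    Function.Injective (stdQuot (K := K) (b := b) i j) :=
  Function.LeftInverse.injective (stdSec_stdQuot h)

variable (b i) in
/-- The index of the last basis vector at `i`. -/
def lastIdx : Fin ((b + simpleDim i) i) := Fin.natAdd (b i) ⟨0, by simp [simpleDim]⟩

variable (K b i) in
/-- The last basis vector at `i`. -/
def lastVec : Fin ((b + simpleDim i) i) → K := Pi.single (lastIdx b i) 1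

theorem eq_zero_simpleDim (t : Fin (simpleDim i i)) : t = ⟨0, by simp [simpleDim]⟩ := by
  have h1 := t.2
  have h2 : simpleDim i i = 1 := Pi.single_eq_same i 1
  exact Fin.ext (show (t : ℕ) = 0 by omega)

theorem stdSub_eq_smul_lastVec (v : Fin (simpleDim i i) → K) :
    stdSub i i v = v ⟨0, by simp [simpleDim]⟩ • lastVec K b i := by
  funext a
  refine Fin.addCases (fun c => ?_) (fun c => ?_) a
  · have h1 : stdSub i i v (Fin.castAdd (simpleDim i i) c) = 0 :=
      Fin.append_left (0 : Fin (b i) → K) v c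
    refine h1.trans ?_
    have : Fin.castAdd (simpleDim i i) c ≠ lastIdx b i := by
      intro h
      have h2 := congrArg Fin.val h
      have h3 := c.2
      simp only [lastIdx, Fin.val_castAdd, Fin.val_natAdd] at h2
      omega
    rw [Pi.smul_apply, lastVec]
    refine (mul_eq_zero_of_right _ ?_).symm
    exact Pi.single_eq_of_ne this _
  · have h1 : stdSub (b := b) i i v (Fin.natAdd (b i) c) = v c :=
      Fin.append_right (0 : Fin (b i) → K) v c
    refine h1.trans ?_
    rw [eq_zero_simpleDim c, Pi.smul_apply, lastVec]
    have : (Pi.single (lastIdx b i) 1 : Fin ((b + simpleDim i) i) → K)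
        (Fin.natAdd (b i) ⟨0, by simp [simpleDim]⟩) = 1 := Pi.single_eq_same _ _
    rw [smul_eq_mul]
    exact ((congrArg _ this).trans (mul_one _)).symm

theorem lastVec_eq_stdSub : lastVec K b i = stdSub i i (fun _ => 1) := by
  rw [stdSub_eq_smul_lastVec, one_smul]

theorem stdQuot_lastVec : stdQuot i i (lastVec K b i) = 0 := by
  rw [lastVec_eq_stdSub, stdQuot_stdSub]

theorem std_decomp_lastVec (v : Fin ((b + simpleDim i) i) → K) :
    v = stdSec i i (stdQuot i i v) + v (lastIdx b i) • lastVec K b i := by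
  conv_lhs => rw [std_decomp i v, stdSub_eq_smul_lastVec]
  rfl

/-- `f'` is the quotient of `f` by the span of the last basis vector at `i`. -/
def IsQuot (f : Rep K (b + simpleDim i)) (f' : Rep K b) : Prop :=
  ∀ ⦃j l : Vertex m⦄ (τ : j ⟶ l), stdQuot i l ∘ₗ f τ = f' τ ∘ₗ stdQuot i j

theorem IsQuot.apply {f : Rep K (b + simpleDim i)} {f' : Rep K b} (h : IsQuot f f')
    {j l : Vertex m} (τ : j ⟶ l) (v : Fin ((b + simpleDim i) j) → K) :
    stdQuot i l (f τ v) = f' τ (stdQuot i j v) := LinearMap.congr_fun (h τ) v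

theorem IsQuot.eval {f : Rep K (b + simpleDim i)} {f' : Rep K b} (h : IsQuot f f')
    {j l : Vertex m} (p : Quiver.Path j l) :
    stdQuot i l ∘ₗ f.eval p = f'.eval p ∘ₗ stdQuot i j := by
  induction p with
  | nil => rfl
  | cons p τ ih =>
    simp only [Rep.eval]
    rw [← LinearMap.comp_assoc, h, LinearMap.comp_assoc, ih, LinearMap.comp_assoc]

theorem IsQuot.commutes {f : Rep K (b + simpleDim i)} {f' : Rep K b} (h : IsQuot f f')
    (hf : f.Commutes) : f'.Commutes := by
  intro j l p q
  rw [← LinearMap.cancel_right (stdQuot_surjective (i := i) j), ← h.eval, ← h.eval, hf j l p q]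

theorem IsQuot.unique {f : Rep K (b + simpleDim i)} {f' f'' : Rep K b} (h : IsQuot f f')
    (h' : IsQuot f f'') : f' = f'' := by
  funext j l τ
  rw [← LinearMap.cancel_right (stdQuot_surjective (i := i) j), ← h, ← h']

/-- A representation with a commutative quotient is commutative if the squares that end in `i`
are. -/
theorem IsQuot.commutes_of_squares {f : Rep K (b + simpleDim i)} {f' : Rep K b}
    (h : IsQuot f f') (hf' : f'.Commutes)
    (hsq : ∀ (l j j' : Vertex m) (σ : l ⟶ j) (τ : j ⟶ i) (σ' : l ⟶ j') (τ' : j' ⟶ i),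
      j ≠ j' → f τ ∘ₗ f σ = f τ' ∘ₗ f σ') : f.Commutes := by
  -- Away from `i` the projection is injective, so equality of paths is inherited from the quotient.
  have hne : ∀ (j l : Vertex m) (p q : Quiver.Path j l), l ≠ i → f.eval p = f.eval q := by
    intro j l p q hl
    rw [← LinearMap.cancel_left (stdQuot_injective (K := K) (b := b) hl), h.eval, h.eval,
      hf' j l p q]
  intro j l p q
  by_cases hl : l = i
  · subst hl
    cases p with
    | nil =>
      cases q with
      | nil => rfl
      | cons q τ => exact (isEmpty_path_of_arrow τ.down q).elim
    | @cons c _ p τ =>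
      cases q with
      | nil => exact (isEmpty_path_of_arrow τ.down p).elim
      | @cons c' _ q τ' =>
        simp only [Rep.eval]
        by_cases hcc : c = c'
        · subst hcc
          rw [Subsingleton.elim τ τ', hne _ _ p q τ.down.ne]
        -- Both paths are rerouted through the bottom `s` of the square spanned by their last
        -- arrows; `s` is a coordinatewise minimum, hence still reachable from `j`.
        · obtain ⟨s, hs, hs', hmin⟩ := exists_square τ.down τ'.down hcc
          obtain ⟨r⟩ : Nonempty (Quiver.Path j s) := nonempty_path_of_le fun t => by
            have h1 := le_of_path p t
            have h2 := le_of_path q t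
            rw [hmin]
            omega
          rw [hne _ _ p (r.cons ⟨hs⟩) τ.down.ne, hne _ _ q (r.cons ⟨hs'⟩) τ'.down.ne]
          simp only [Rep.eval]
          rw [← LinearMap.comp_assoc, ← LinearMap.comp_assoc, hsq _ _ _ ⟨hs⟩ τ ⟨hs'⟩ τ' hcc]
  · exact hne j l p q hl

/-- The extension with standard maps. -/
def IsQuot.toExtPoint {f : Rep K (b + simpleDim i)} {f' : Rep K b} (h : IsQuot f f')
    (hf : f.Commutes) : ExtPoint K (simpleDim i) b (b + simpleDim i) where
  sub := stdSub i
  quot := stdQuot i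
  rep := f
  injective := stdSub_injective
  exact := stdSub_stdQuot_exact
  surjective := stdQuot_surjective
  commutes := hf
  stable := by
    rintro j l τ _ ⟨v, rfl⟩
    refine (stdSub_stdQuot_exact l _).1 ?_
    rw [LinearMap.comp_apply, h.apply, stdQuot_stdSub, map_zero]

theorem IsQuot.quotRep_toExtPoint {f : Rep K (b + simpleDim i)} {f' : Rep K b} (h : IsQuot f f')
    (hf : f.Commutes) : (h.toExtPoint hf).quotRep = f' := by
  have : IsQuot f (h.toExtPoint hf).quotRep :=
    fun j l τ => ((h.toExtPoint hf).quotRep_comp τ).symm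
  exact this.unique h

/-- After a change of bases, an extension has standard maps. -/
theorem ExtPoint.exists_isQuot (x : ExtPoint K (simpleDim i) b (b + simpleDim i)) :
    ∃ h : ∀ j, Matrix (Fin ((b + simpleDim i) j)) (Fin ((b + simpleDim i) j)) K,
      (∀ j, (h j).det ≠ 0) ∧ IsQuot (x.rep.conj h) x.quotRep := by
  have key : ∀ j, ∃ h : Matrix (Fin ((b + simpleDim i) j)) (Fin ((b + simpleDim i) j)) K,
      h.det ≠ 0 ∧ x.quot j ∘ₗ Matrix.toLin' h = stdQuot i j := by
    intro j
    obtain ⟨s, hs⟩ := (x.quot j).exists_rightInverse_of_surjective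
      (LinearMap.range_eq_top.2 (x.surjective j))
    -- A basis adapted to the extension: a section of the quotient on the first coordinates, the
    -- subspace on the last.
    let g : (Fin ((b + simpleDim i) j) → K) →ₗ[K] (Fin ((b + simpleDim i) j) → K) :=
      s ∘ₗ stdQuot i j + x.sub j ∘ₗ stdPart i j
    have hg : x.quot j ∘ₗ g = stdQuot i j := by
      refine LinearMap.ext fun v => ?_
      have h1 := LinearMap.congr_fun hs (stdQuot i j v)
      have h2 := (x.exact j).apply_apply_eq_zero (stdPart i j v)
      simp only [LinearMap.comp_apply, LinearMap.id_apply] at h1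
      simp only [g, LinearMap.comp_apply, LinearMap.add_apply, map_add, h1, h2, add_zero]
    have hinj : Function.Injective g := by
      rw [injective_iff_map_eq_zero]
      intro v hv
      have h1 : stdQuot i j v = 0 := by
        rw [← hg, LinearMap.comp_apply, hv, map_zero]
      have h2 : x.sub j (stdPart i j v) = 0 := by
        have : g v = s (stdQuot i j v) + x.sub j (stdPart i j v) := rfl
        rw [hv, h1, map_zero, zero_add] at this
        exact this.symm
      rw [map_eq_zero_iff _ (x.injective j)] at h2
      rw [std_decomp j v, h1, h2, map_zero, map_zero, add_zero]
    exact ⟨LinearMap.toMatrix' g, det_toMatrix_ne_zero hinj, by rw [Matrix.toLin'_toMatrix', hg]⟩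
  choose h hh hq using key
  refine ⟨h, hh, fun j l τ => ?_⟩
  rw [← hq, ← hq, LinearMap.comp_assoc, Rep.conj_comp hh, ← LinearMap.comp_assoc,
    ← x.quotRep_comp, LinearMap.comp_assoc]

/-- `ε*_i` drops by one under the quotient. -/
theorem IsQuot.epsStarPt_eq {f : EC k K (b + simpleDim i)} {f' : EC k K b}
    (h : IsQuot f.1 f'.1) : epsStarPt i f = epsStarPt i f' + 1 := by
  let g' := LinearMap.pi (fun τ : (Σ j : Vertex m, (i ⟶ j)) => f'.1 τ.2)
  -- The grid has no loops, so every arrow out of `i` ends where the projection is injective. The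
  -- kernel for `f` is therefore the preimage of the kernel for `f'`.
  have hker : LinearMap.ker (LinearMap.pi (fun τ : (Σ j : Vertex m, (i ⟶ j)) => f.1 τ.2)) =
      LinearMap.ker (g' ∘ₗ stdQuot i i) := by
    ext v
    rw [LinearMap.mem_ker, LinearMap.mem_ker, funext_iff, funext_iff]
    refine forall_congr' fun τ => ?_
    have h1 := h.apply τ.2 v
    simp only [g', LinearMap.pi_apply, LinearMap.comp_apply]
    refine Iff.trans ?_ (Eq.congr h1 rfl)
    exact (map_eq_zero_iff _ (stdQuot_injective τ.2.down.ne.symm)).symm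
  have h1 := (g' ∘ₗ stdQuot (K := K) (b := b) i i).finrank_range_add_finrank_ker
  have h2 := g'.finrank_range_add_finrank_ker
  rw [LinearMap.range_comp_of_range_eq_top _
    (LinearMap.range_eq_top.2 (stdQuot_surjective i))] at h1
  have h3 : (b + simpleDim i) i = b i + 1 := by simp [simpleDim]
  have h4 : Module.finrank K (Fin ((b + simpleDim i) i) → K) = b i + 1 := by
    rw [Module.finrank_fin_fun, h3]
  rw [Module.finrank_fin_fun] at h2
  have e1 : epsStarPt i f = Module.finrank K (LinearMap.ker (g' ∘ₗ stdQuot i i)) := by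
    rw [epsStarPt, hker]
  have e2 : epsStarPt i f' = Module.finrank K (LinearMap.ker g') := rfl
  rw [e1, e2]
  omega

/-- `ε*_i` drops by one along an extension. -/
theorem ExtPoint.epsStarPt_varpi4 (x : ExtPoint K (simpleDim i) b (b + simpleDim i)) :
    epsStarPt i (varpi4 k x) = epsStarPt i (varpi3 k x) + 1 := by
  obtain ⟨h, hh, hQ⟩ := x.exists_isQuot
  rw [← epsStarPt_conjEC hh]
  refine IsQuot.epsStarPt_eq ?_
  rw [conjEC_val hh]
  exact hQ

/-- A representation has a standard quotient if the last basis vector is in the kernel of the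
outgoing maps. -/
theorem exists_isQuot_iff {f : Rep K (b + simpleDim i)} :
    (∃ f', IsQuot f f') ↔ ∀ (j : Vertex m) (τ : i ⟶ j), f τ (lastVec K b i) = 0 := by
  constructor
  · rintro ⟨f', h⟩ j τ
    rw [← map_eq_zero_iff _ (stdQuot_injective τ.down.ne.symm), h.apply, stdQuot_lastVec, map_zero]
  · intro h
    refine ⟨fun j l τ => stdQuot i l ∘ₗ f τ ∘ₗ stdSec i j, fun j l τ => LinearMap.ext fun v => ?_⟩
    simp only [LinearMap.comp_apply]
    by_cases hj : j = i
    · subst hj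
      conv_lhs => rw [std_decomp_lastVec v, map_add, map_smul, h, smul_zero, add_zero]
    · rw [stdSec_stdQuot hj]

end Standard

/-! ## Extensions and the kernel of `F_i` -/

section Extensions

variable {d : ℕ} {m : Fin d → ℕ} {k K : Type*} [Field K] {b : Vertex m → ℕ} {i : Vertex m}

theorem transposeMap_dotProduct {p q : ℕ} (g : (Fin p → K) →ₗ[K] (Fin q → K)) (ξ : Fin q → K)
    (u : Fin p → K) : transposeMap g ξ ⬝ᵥ u = ξ ⬝ᵥ g u := by
  rw [transposeMap, Matrix.toLin'_apply, Matrix.mulVec_transpose, ← Matrix.dotProduct_mulVec]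
  conv_rhs => rw [← Matrix.toLin'_toMatrix' g, Matrix.toLin'_apply]

/-- Exactly two vertices of `in₁(i)` receive an arrow from `l`, so row `l` of `F_i` has two possibly
nonzero blocks, with opposite signs. -/
theorem FStar_apply_of_lexLT (f : EC k K b) (w : (j : in1 i) → Fin (b j) → K) {l j₁ j₂ : Vertex m}
    (hl : l ∈ in2 i) (h₁ : IsArrow j₁ i) (h₂ : IsArrow j₂ i) (hl₁ : IsArrow l j₁)
    (hl₂ : IsArrow l j₂) (hlt : LexLT j₁ j₂) :
    FStar i f w ⟨l, hl⟩ = transposeMap (f.1 ⟨hl₁⟩) (w ⟨j₁, h₁⟩) -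
      transposeMap (f.1 ⟨hl₂⟩) (w ⟨j₂, h₂⟩) := by
  classical
  have hne : j₁ ≠ j₂ := by
    rintro rfl
    exact lt_irrefl _ hlt
  have hcases : ∀ j, IsArrow j i → IsArrow l j → j = j₁ ∨ j = j₂ :=
    fun j hj hlj => eq_or_eq_of_square h₁ h₂ hne hl₁ hl₂ hj hlj
  have e1 : FStarComp i f j₁ l = transposeMap (f.1 ⟨hl₁⟩) := by
    rw [FStarComp, dif_pos ⟨hl₁, j₂, h₂, hlt, hl₂⟩]
  have e2 : FStarComp i f j₂ l = -transposeMap (f.1 ⟨hl₂⟩) := by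
    rw [FStarComp, dif_neg, dif_pos ⟨hl₂, j₁, h₁, hlt, hl₁⟩]
    rintro ⟨-, j', hj', hlt', hlj'⟩
    rcases hcases j' hj' hlj' with rfl | rfl
    · exact lt_asymm hlt hlt'
    · exact lt_irrefl _ hlt'
  have e3 : ∀ j : in1 i, j ≠ ⟨j₁, h₁⟩ ∧ j ≠ ⟨j₂, h₂⟩ → FStarComp i f j l = 0 := by
    rintro ⟨j, hj⟩ ⟨hj1, hj2⟩
    have : ¬ IsArrow l j := fun hlj => by
      rcases hcases j hj hlj with rfl | rfl
      · exact hj1 rfl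
      · exact hj2 rfl
    rw [FStarComp, dif_neg fun h => this h.1, dif_neg fun h => this h.1]
  simp only [FStar, LinearMap.pi_apply, LinearMap.sum_apply, LinearMap.comp_apply,
    LinearMap.proj_apply]
  rw [Fintype.sum_eq_add (⟨j₁, h₁⟩ : in1 i) ⟨j₂, h₂⟩ (fun h => hne (congrArg Subtype.val h))
    fun j hj => by rw [e3 j hj, LinearMap.zero_apply], e1, e2, LinearMap.neg_apply, sub_eq_add_neg]

theorem lexLT_or_lexLT {j j' : Vertex m} (h : j ≠ j') : LexLT j j' ∨ LexLT j' j :=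
  lt_or_gt_of_ne fun h' : @toLex (∀ l, Fin (m l)) j = @toLex (∀ l, Fin (m l)) j' =>
    h (toLex.injective h')

/-- Each row of `F_i` is a difference over one square. The lexicographic order fixes only its sign,
which is irrelevant for the kernel. -/
theorem FStar_eq_zero_iff {f : EC k K b} {w : (j : in1 i) → Fin (b j) → K} :
    FStar i f w = 0 ↔ ∀ (l j j' : Vertex m) (hj : IsArrow j i) (hj' : IsArrow j' i)
      (hl : IsArrow l j) (hl' : IsArrow l j'), j ≠ j' →
      transposeMap (f.1 ⟨hl⟩) (w ⟨j, hj⟩) = transposeMap (f.1 ⟨hl'⟩) (w ⟨j', hj'⟩) := by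
  constructor
  · intro h l j j' hj hj' hl hl' hne
    have hmem : l ∈ in2 i := ⟨j, hj, j', hj', hne, hl, hl'⟩
    have h0 := congrFun h ⟨l, hmem⟩
    rcases lexLT_or_lexLT hne with hlt | hlt
    · rw [FStar_apply_of_lexLT f w hmem hj hj' hl hl' hlt] at h0
      exact sub_eq_zero.1 h0
    · rw [FStar_apply_of_lexLT f w hmem hj' hj hl' hl hlt] at h0
      exact (sub_eq_zero.1 h0).symm
  · intro h
    funext ⟨l, hmem⟩
    obtain ⟨j, hj, j', hj', hne, hl, hl'⟩ := id hmem
    rcases lexLT_or_lexLT hne with hlt | hlt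
    · rw [FStar_apply_of_lexLT f w hmem hj hj' hl hl' hlt]
      exact sub_eq_zero.2 (h l j j' hj hj' hl hl' hne)
    · rw [FStar_apply_of_lexLT f w hmem hj' hj hl' hl hlt]
      exact sub_eq_zero.2 (h l j' j hj' hj hl' hl hne.symm)

open Classical in
/-- A family of rows indexed by `in₁(i)`, extended by zero. -/
def extRow (w : (Σ j : in1 i, Fin (b j)) → K) (j : Vertex m) : Fin (b j) → K :=
  if h : j ∈ in1 i then fun c => w ⟨⟨j, h⟩, c⟩ else 0

/-- The representation with quotient `f'` in which the arrows that end in `i` have the last rows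
given by `w`. -/
def extRep (f' : Rep K b) (w : (Σ j : in1 i, Fin (b j)) → K) : Rep K (b + simpleDim i) :=
  fun j l τ => stdSec i l ∘ₗ f' τ ∘ₗ stdQuot i j +
    stdSub i l ∘ₗ (Matrix.of fun _ c => extRow w j c).mulVecLin ∘ₗ stdQuot i j

theorem extRep_apply (f' : Rep K b) (w : (Σ j : in1 i, Fin (b j)) → K) {j l : Vertex m}
    (τ : j ⟶ l) (v : Fin ((b + simpleDim i) j) → K) :
    extRep f' w τ v = stdSec i l (f' τ (stdQuot i j v)) +
      stdSub i l (fun _ => extRow w j ⬝ᵥ stdQuot i j v) := rfl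

theorem isQuot_extRep (f' : Rep K b) (w : (Σ j : in1 i, Fin (b j)) → K) :
    IsQuot (extRep f' w) f' := by
  intro j l τ
  refine LinearMap.ext fun v => ?_
  rw [LinearMap.comp_apply, extRep_apply, map_add, stdQuot_stdSec, stdQuot_stdSub, add_zero]
  rfl

/-- The first coordinates of the two composites agree because `f'` commutes. The last coordinate
pairs the row with the image under `f'`, which gives the transposed equation. -/
theorem extRep_comp_eq_iff {f' : Rep K b} (hf' : f'.Commutes) (w : (Σ j : in1 i, Fin (b j)) → K)
    {l j j' : Vertex m} (σ : l ⟶ j) (τ : j ⟶ i) (σ' : l ⟶ j') (τ' : j' ⟶ i) :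
    extRep f' w τ ∘ₗ extRep f' w σ = extRep f' w τ' ∘ₗ extRep f' w σ' ↔
      transposeMap (f' σ) (extRow w j) = transposeMap (f' σ') (extRow w j') := by
  have hc : f' τ ∘ₗ f' σ = f' τ' ∘ₗ f' σ' :=
    hf' l i ((Quiver.Path.nil.cons σ).cons τ) ((Quiver.Path.nil.cons σ').cons τ')
  have key : ∀ v : Fin ((b + simpleDim i) l) → K,
      (extRep f' w τ ∘ₗ extRep f' w σ) v = (extRep f' w τ' ∘ₗ extRep f' w σ') v ↔
      transposeMap (f' σ) (extRow w j) ⬝ᵥ stdQuot i l v =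
        transposeMap (f' σ') (extRow w j') ⬝ᵥ stdQuot i l v := by
    intro v
    have h1 : f' τ (f' σ (stdQuot i l v)) = f' τ' (f' σ' (stdQuot i l v)) :=
      LinearMap.congr_fun hc _
    rw [LinearMap.comp_apply, LinearMap.comp_apply, extRep_apply f' w τ, extRep_apply f' w τ',
      (isQuot_extRep f' w).apply, (isQuot_extRep f' w).apply, h1, add_right_inj,
      (stdSub_injective i).eq_iff, transposeMap_dotProduct, transposeMap_dotProduct]
    exact ⟨fun h => congrFun h ⟨0, by simp [simpleDim]⟩, fun h => funext fun _ => h⟩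
  constructor
  · intro h
    refine dotProduct_eq _ _ fun u => ?_
    have := (key (stdSec i l u)).1 (LinearMap.congr_fun h _)
    rwa [stdQuot_stdSec] at this
  · intro h
    exact LinearMap.ext fun v => (key v).2 (by rw [h])

open Classical in
-- Since the quotient commutes, only the squares ending in `i` impose conditions, and these are the
-- equations of `F_i`.
theorem extRep_commutes_iff {f' : EC k K b} {w : (Σ j : in1 i, Fin (b j)) → K} :
    (extRep f'.1 w).Commutes ↔ (fMat i f').mulVec w = 0 := by
  have h0 : (fMat i f').mulVec w = 0 ↔ FStar i f' (fun j c => w ⟨j, c⟩) = 0 := by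
    constructor
    · intro h
      funext l c
      exact (fMat_mulVec i f' w ⟨l, c⟩).symm.trans (congrFun h _)
    · intro h
      funext a
      rw [fMat_mulVec]
      exact congrFun (congrFun h a.1) a.2
  have hrow : ∀ (j : Vertex m) (hj : IsArrow j i), extRow w j = fun c => w ⟨⟨j, hj⟩, c⟩ :=
    fun j hj => dif_pos hj
  rw [h0, FStar_eq_zero_iff]
  constructor
  · intro h l j j' hj hj' hl hl' hne
    let σ : l ⟶ j := ⟨hl⟩
    let τ : j ⟶ i := ⟨hj⟩
    let σ' : l ⟶ j' := ⟨hl'⟩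
    let τ' : j' ⟶ i := ⟨hj'⟩
    have := (extRep_comp_eq_iff f'.2 w σ τ σ' τ').1
      (h l i ((Quiver.Path.nil.cons σ).cons τ) ((Quiver.Path.nil.cons σ').cons τ'))
    rwa [hrow j hj, hrow j' hj'] at this
  · intro h
    refine (isQuot_extRep f'.1 w).commutes_of_squares f'.2 fun l j j' σ τ σ' τ' hne => ?_
    rw [extRep_comp_eq_iff f'.2, hrow j τ.down, hrow j' τ'.down]
    exact h l j j' τ.down τ'.down σ.down σ'.down hne

theorem IsQuot.exists_eq_extRep {f : Rep K (b + simpleDim i)} {f' : Rep K b} (h : IsQuot f f') :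
    ∃ w : (Σ j : in1 i, Fin (b j)) → K, f = extRep f' w := by
  classical
  -- The rows are read off as the last coordinates at `i` of the images of the basis vectors.
  refine ⟨fun e => f ⟨e.1.2⟩ (stdSec i e.1 (Pi.single e.2 1)) (lastIdx b i), ?_⟩
  funext j l τ
  by_cases hl : l = i
  · subst hl
    have hj : j ≠ l := τ.down.ne
    have h1 : f τ ∘ₗ stdSec l j = extRep f' (fun e : Σ j : in1 l, Fin (b j) =>
        f ⟨e.1.2⟩ (stdSec l e.1 (Pi.single e.2 1)) (lastIdx b l)) τ ∘ₗ stdSec l j := by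
      refine LinearMap.pi_ext' fun c => LinearMap.ext_ring ?_
      simp only [LinearMap.comp_apply, LinearMap.single_apply]
      rw [extRep_apply, stdQuot_stdSec, stdSub_eq_smul_lastVec, dotProduct_single, mul_one]
      conv_lhs => rw [std_decomp_lastVec (f τ _), h.apply, stdQuot_stdSec]
      have : extRow (fun e : Σ j : in1 l, Fin (b j) =>
          f ⟨e.1.2⟩ (stdSec l e.1 (Pi.single e.2 1)) (lastIdx b l)) j =
          fun c => f τ (stdSec l j (Pi.single c 1)) (lastIdx b l) := dif_pos τ.down
      rw [this]
    refine LinearMap.ext fun v => ?_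
    rw [← stdSec_stdQuot hj v]
    exact LinearMap.congr_fun h1 (stdQuot l j v)
  · rw [← LinearMap.cancel_left (stdQuot_injective (K := K) (b := b) hl), h, isQuot_extRep]

open Classical in
/-- The point of `E_C` with quotient `f'` and last rows `w`. -/
def extEC (f' : EC k K b) (w : (Σ j : in1 i, Fin (b j)) → K) : EC k K (b + simpleDim i) :=
  if h : (fMat i f').mulVec w = 0 then ⟨extRep f'.1 w, extRep_commutes_iff.2 h⟩
  else ⟨extRep f'.1 (0 : (Σ j : in1 i, Fin (b j)) → K),
    extRep_commutes_iff.2 (Matrix.mulVec_zero _)⟩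

open Classical in
theorem extEC_val {f' : EC k K b} {w : (Σ j : in1 i, Fin (b j)) → K}
    (h : (fMat i f').mulVec w = 0) : (extEC f' w).1 = extRep f'.1 w :=
  congrArg (fun g : EC k K (b + simpleDim i) => g.1) (dif_pos h)

/-- The transport of an extension under a change of bases. -/
def ExtPoint.conj {a n : Vertex m → ℕ} (x : ExtPoint K a b n)
    {h : ∀ j, Matrix (Fin (n j)) (Fin (n j)) K} (hh : ∀ j, (h j).det ≠ 0) :
    ExtPoint K a b n where
  sub j := Matrix.toLin' (h j)⁻¹ ∘ₗ x.sub j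
  quot j := x.quot j ∘ₗ Matrix.toLin' (h j)
  rep := x.rep.conj h
  injective j := (mulVec_injective_of_det_ne_zero (det_inv_ne_zero hh j)).comp (x.injective j)
  exact j := by
    have h1 := Matrix.mul_nonsing_inv _ (isUnit_iff_ne_zero.2 (hh j))
    have h2 := Matrix.nonsing_inv_mul _ (isUnit_iff_ne_zero.2 (hh j))
    intro v
    rw [LinearMap.comp_apply, x.exact j]
    constructor
    · rintro ⟨u, hu⟩
      exact ⟨u, by rw [LinearMap.comp_apply, hu, ← LinearMap.comp_apply, ← Matrix.toLin'_mul, h2,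
        Matrix.toLin'_one, LinearMap.id_apply]⟩
    · rintro ⟨u, rfl⟩
      exact ⟨u, by rw [LinearMap.comp_apply, ← LinearMap.comp_apply (Matrix.toLin' (h j)),
        ← Matrix.toLin'_mul, h1, Matrix.toLin'_one, LinearMap.id_apply]⟩
  surjective j := (x.surjective j).comp (LinearMap.injective_iff_surjective.1
    (mulVec_injective_of_det_ne_zero (hh j)))
  commutes := x.commutes.conj hh
  stable := by
    rintro j l τ _ ⟨v, rfl⟩
    have h1 := Matrix.mul_nonsing_inv _ (isUnit_iff_ne_zero.2 (hh j))
    obtain ⟨u, hu⟩ := x.stable j l τ ⟨v, rfl⟩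
    refine ⟨u, mulVec_injective_of_det_ne_zero (hh l) ?_⟩
    have h3 := LinearMap.congr_fun (Rep.conj_comp hh x.rep τ)
      (Matrix.toLin' (h j)⁻¹ (x.sub j v))
    rw [LinearMap.comp_apply, LinearMap.comp_apply,
      ← LinearMap.comp_apply (Matrix.toLin' (h j)), ← Matrix.toLin'_mul, h1, Matrix.toLin'_one,
      LinearMap.id_apply] at h3
    rw [LinearMap.comp_apply, ← LinearMap.comp_apply (Matrix.toLin' (h l)), ← Matrix.toLin'_mul,
      Matrix.mul_nonsing_inv _ (isUnit_iff_ne_zero.2 (hh l)), Matrix.toLin'_one,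
      LinearMap.id_apply, hu]
    exact h3.symm

theorem ExtPoint.quotRep_eq {a n : Vertex m → ℕ} (x : ExtPoint K a b n) {g : Rep K b}
    (h : ∀ ⦃j l : Vertex m⦄ (τ : j ⟶ l), g τ ∘ₗ x.quot j = x.quot l ∘ₗ x.rep τ) :
    x.quotRep = g := by
  funext j l τ
  rw [← LinearMap.cancel_right (x.surjective j), x.quotRep_comp, h]

theorem ExtPoint.quotRep_conj {a n : Vertex m → ℕ} (x : ExtPoint K a b n)
    {h : ∀ j, Matrix (Fin (n j)) (Fin (n j)) K} (hh : ∀ j, (h j).det ≠ 0) :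
    (x.conj hh).quotRep = x.quotRep := by
  refine (x.conj hh).quotRep_eq fun j l τ => ?_
  change x.quotRep τ ∘ₗ x.quot j ∘ₗ Matrix.toLin' (h j) =
    (x.quot l ∘ₗ Matrix.toLin' (h l)) ∘ₗ x.rep.conj h τ
  rw [LinearMap.comp_assoc, Rep.conj_comp hh, ← LinearMap.comp_assoc, ← LinearMap.comp_assoc,
    x.quotRep_comp]

/-- The points with a standard quotient in `T`. -/
def stdExt (i : Vertex m) (T : Set (EC k K b)) : Set (EC k K (b + simpleDim i)) :=
  {g | ∃ f' ∈ T, IsQuot g.1 f'.1}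

/-- The standard quotients of the points of `T`. -/
def stdQuots (i : Vertex m) (T : Set (EC k K (b + simpleDim i))) : Set (EC k K b) :=
  {f' | ∃ f ∈ T, IsQuot f.1 f'.1}

/-- A change of bases makes the maps of an extension standard without altering its quotient
representation, so the arbitrary choices of maps contribute exactly the orbits. -/
theorem varpi4_image_eq (T : Set (EC k K b)) :
    varpi4 k '' ((varpi3 k : ExtPoint K (simpleDim i) b (b + simpleDim i) → EC k K b) ⁻¹' T) =
      orbits (stdExt i T) := by
  ext f
  constructor
  · rintro ⟨x, hx, rfl⟩
    obtain ⟨h, hh, hQ⟩ := x.exists_isQuot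
    refine ⟨conjEC h (varpi4 k x), ⟨varpi3 k x, hx, ?_⟩, _, det_inv_ne_zero hh,
      conjEC_conjEC_inv hh _⟩
    rw [conjEC_val hh]
    exact hQ
  · rintro ⟨g, ⟨f', hf', hQ⟩, h, hh, rfl⟩
    refine ⟨(hQ.toExtPoint g.2).conj hh, ?_, Subtype.ext (conjEC_val hh g).symm⟩
    have : varpi3 k ((hQ.toExtPoint g.2).conj hh) = f' :=
      Subtype.ext ((ExtPoint.quotRep_conj _ hh).trans (hQ.quotRep_toExtPoint g.2))
    rw [Set.mem_preimage, this]
    exact hf'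

/-- The quotient coordinates can be kept while the middle bases are adapted, so stability of `T` in
the middle suffices and no orbits appear. -/
theorem varpi3_image_eq {T : Set (EC k K (b + simpleDim i))}
    (hT : ∀ f ∈ T, ∀ h : ∀ j, Matrix (Fin ((b + simpleDim i) j)) (Fin ((b + simpleDim i) j)) K,
      (∀ j, (h j).det ≠ 0) → conjEC h f ∈ T) :
    varpi3 k '' ((varpi4 k : ExtPoint K (simpleDim i) b (b + simpleDim i) →
      EC k K (b + simpleDim i)) ⁻¹' T) = stdQuots i T := by
  ext f'
  constructor
  · rintro ⟨x, hx, rfl⟩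
    obtain ⟨h, hh, hQ⟩ := x.exists_isQuot
    refine ⟨conjEC h (varpi4 k x), hT _ hx h hh, ?_⟩
    rw [conjEC_val hh]
    exact hQ
  · rintro ⟨f, hf, hQ⟩
    exact ⟨hQ.toExtPoint f.2, hf, Subtype.ext (hQ.quotRep_toExtPoint f.2)⟩

/-- Every basis vector can be sent to any nonzero vector by an invertible map. -/
theorem exists_injective_apply_eq {n : ℕ} (l : Fin n) {v : Fin n → K} (hv : v ≠ 0) :
    ∃ e : (Fin n → K) →ₗ[K] (Fin n → K), Function.Injective e ∧ e (Pi.single l 1) = v := by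
  obtain ⟨φ, h1, h2⟩ : ∃ φ : (Fin n → K) →ₗ[K] K, φ (Pi.single l 1) = 1 ∧ φ v ≠ 0 := by
    by_cases hl : v l = 0
    · obtain ⟨a, ha⟩ := Function.ne_iff.1 hv
      have hal : a ≠ l := by
        rintro rfl
        exact ha hl
      refine ⟨LinearMap.proj (R := K) (φ := fun _ : Fin n => K) l +
        LinearMap.proj (R := K) (φ := fun _ : Fin n => K) a, ?_, ?_⟩
      · simp [LinearMap.add_apply, hal]
      · simpa [LinearMap.add_apply, hl] using ha
    · exact ⟨LinearMap.proj l, by simp, hl⟩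
  -- Since `φ` takes the value `1` on the basis vector, applying `φ` to the image of `x` gives `φ x
  -- * φ v`; this yields injectivity.
  refine ⟨LinearMap.id + φ.smulRight (v - Pi.single l 1), ?_, by simp [h1]⟩
  rw [injective_iff_map_eq_zero]
  intro x hx
  have h3 : x + φ x • (v - Pi.single l 1) = 0 := hx
  have h4 := congrArg φ h3
  simp only [map_add, map_smul, map_sub, h1, smul_eq_mul, map_zero] at h4
  have h5 : φ x * φ v = 0 := by linear_combination h4
  rw [(mul_eq_zero.1 h5).resolve_right h2, zero_smul, add_zero] at h3
  exact h3

/-- An extension exists at every point at which the kernel is not zero. -/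
theorem exists_conjEC_isQuot {f : EC k K (b + simpleDim i)} (hf : 0 < epsStarPt i f) :
    ∃ h : ∀ j, Matrix (Fin ((b + simpleDim i) j)) (Fin ((b + simpleDim i) j)) K,
      (∀ j, (h j).det ≠ 0) ∧ ∃ f', IsQuot (f.1.conj h) f' := by
  classical
  obtain ⟨⟨v, hv⟩, hv0⟩ := Module.finrank_pos_iff_exists_ne_zero.1 hf
  have hv0' : v ≠ 0 := fun h => hv0 (Subtype.ext h)
  obtain ⟨e, hinj, he⟩ := exists_injective_apply_eq (lastIdx b i) hv0'
  let h : ∀ j, Matrix (Fin ((b + simpleDim i) j)) (Fin ((b + simpleDim i) j)) K :=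
    Function.update (fun _ => 1) i (LinearMap.toMatrix' e)
  have hi : h i = LinearMap.toMatrix' e := Function.update_self _ _ _
  have hh : ∀ j, (h j).det ≠ 0 := by
    intro j
    by_cases hj : j = i
    · subst hj
      rw [hi]
      exact det_toMatrix_ne_zero hinj
    · simp only [h]
      rw [Function.update_of_ne hj, Matrix.det_one]
      exact one_ne_zero
  refine ⟨h, hh, exists_isQuot_iff.2 fun j τ => ?_⟩
  rw [conj_apply_eq_zero_iff hh, hi, ← Matrix.toLin'_apply, Matrix.toLin'_toMatrix']
  have h1 : e (lastVec K b i) = v := he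
  exact (congrArg (f.1 τ) h1).trans (congrFun (LinearMap.mem_ker.1 hv) ⟨j, τ⟩)

theorem toMatrix_apply_eq {p q : ℕ} (g : (Fin p → K) →ₗ[K] (Fin q → K)) (a : Fin q) (c : Fin p) :
    LinearMap.toMatrix' g a c = g (Pi.single c 1) a := by
  rw [LinearMap.toMatrix'_apply]

theorem stdQuot_single_castAdd {j : Vertex m} (c : Fin (b j)) :
    stdQuot i j (Pi.single (Fin.castAdd (simpleDim i j) c) 1 : Fin ((b + simpleDim i) j) → K) =
      Pi.single c 1 := by
  funext t
  change (Pi.single (Fin.castAdd (simpleDim i j) c) 1 : Fin (b j + simpleDim i j) → K)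
    (Fin.castAdd (simpleDim i j) t) = _
  simp [Pi.single_apply]

theorem IsQuot.toMatrix_apply {f : Rep K (b + simpleDim i)} {f' : Rep K b} (h : IsQuot f f')
    {j l : Vertex m} (τ : j ⟶ l) (a : Fin (b l)) (c : Fin (b j)) :
    LinearMap.toMatrix' (f τ) (Fin.castAdd (simpleDim i l) a) (Fin.castAdd (simpleDim i j) c) =
      LinearMap.toMatrix' (f' τ) a c := by
  have h1 := h.apply τ (Pi.single (Fin.castAdd (simpleDim i j) c) 1)
  rw [stdQuot_single_castAdd] at h1
  rw [toMatrix_apply_eq (f' τ), ← h1]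
  exact toMatrix_apply_eq (f τ) _ _

theorem epsMat_mulVec_lastVec_eq_zero_iff {f : EC k K (b + simpleDim i)} :
    (epsMat i f).mulVec (lastVec K b i) = 0 ↔ ∃ f', IsQuot f.1 f' := by
  rw [epsMat_mulVec_eq_zero_iff, exists_isQuot_iff]

/-- The split extension, with zero rows, always exists. -/
theorem exists_isQuot_lift (i : Vertex m) (f' : EC k K b) :
    ∃ f : EC k K (b + simpleDim i), IsQuot f.1 f'.1 := by
  classical
  refine ⟨extEC f' 0, ?_⟩
  have := isQuot_extRep (i := i) f'.1 0
  rw [← extEC_val (Matrix.mulVec_zero _)] at this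
  exact this

end Extensions

/-! ## Irreducibility of the correspondences -/

section Correspondence

variable {d : ℕ} {m : Fin d → ℕ} {k K : Type*} [Field k] [Field K] [Algebra k K]
  {b : Vertex m → ℕ} {i : Vertex m}

theorem extRep_entry_mem {X : Type*} {A : Subalgebra k (X → K)} {φ : X → EC k K b}
    (hφ : ∀ a ∈ regEC k K b, a ∘ φ ∈ A) {w : X → (Σ j : in1 i, Fin (b j)) → K}
    (hw : ∀ t, (fun x => w x t) ∈ A) {j l : Vertex m} (τ : j ⟶ l) :
    MatReg A fun x => LinearMap.toMatrix' (extRep (φ x).1 (w x) τ) := by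
  intro a c
  refine Fin.addCases (fun c' => ?_) (fun c' => ?_) c
  · refine Fin.addCases (fun a' => ?_) (fun a' => ?_) a
    · simp only [(isQuot_extRep (i := i) _ _).toMatrix_apply]
      exact matReg_comp hφ τ a' c'
    · have h1 : ∀ x, LinearMap.toMatrix' (extRep (φ x).1 (w x) τ) (Fin.natAdd (b l) a')
          (Fin.castAdd (simpleDim i j) c') = extRow (w x) j c' := by
        intro x
        have h2 : stdPart i l (extRep (φ x).1 (w x) τ
            (Pi.single (Fin.castAdd (simpleDim i j) c') 1)) = fun _ => extRow (w x) j c' := by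
          rw [extRep_apply, map_add, stdPart_stdSec, stdPart_stdSub, zero_add,
            stdQuot_single_castAdd]
          simp only [dotProduct_single, mul_one]
        exact (toMatrix_apply_eq (extRep (φ x).1 (w x) τ) _ _).trans (congrFun h2 a')
      simp only [h1, extRow]
      split_ifs
      · exact hw _
      · exact A.zero_mem
  · have hc : stdQuot i j (Pi.single (Fin.natAdd (b j) c') 1 :
        Fin ((b + simpleDim i) j) → K) = 0 := by
      funext t
      have : (Fin.castAdd (simpleDim i j) t) ≠ Fin.natAdd (b j) c' := by
        intro h
        have h2 := congrArg Fin.val h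
        have h3 := t.2
        simp only [Fin.val_castAdd, Fin.val_natAdd] at h2
        omega
      exact Pi.single_eq_of_ne this _
    have h1 : ∀ x, extRep (φ x).1 (w x) τ (Pi.single (Fin.natAdd (b j) c') 1) = 0 := by
      intro x
      rw [extRep_apply, hc, map_zero, map_zero, zero_add, dotProduct_zero]
      exact map_zero (stdSub i l)
    have h2 : ∀ x, LinearMap.toMatrix' (extRep (φ x).1 (w x) τ) a (Fin.natAdd (b j) c') = 0 :=
      fun x => (toMatrix_apply_eq (extRep (φ x).1 (w x) τ) _ _).trans (congrFun (h1 x) a)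
    exact (congrArg (· ∈ A) (funext h2)).mpr A.zero_mem

/-- The set is the regular image of the family of kernels of `F_i` over `T`, and these have constant
dimension by hypothesis. -/
theorem isPreirr_stdExt [Infinite K] {T : Set (EC k K b)} (hT : IsPreirr (regEC k K b) T)
    (hc : ∀ f ∈ T, ∀ g ∈ T, Module.finrank K (ExtStar i f) = Module.finrank K (ExtStar i g)) :
    IsPreirr (regEC k K (b + simpleDim i)) (stdExt i T) := by
  classical
  have h1 := hT.kernels (matReg_fMat i) fun f hf g hg => rank_eq_of_finrank_ker_eq
    (by rw [← finrank_extStar_eq, ← finrank_extStar_eq]; exact hc f hf g hg)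
  have h2 : stdExt i T = (fun p => extEC (i := i) p.1 p.2) ''
      {p : EC k K b × ((Σ j : in1 i, Fin (b j)) → K) |
        p.1 ∈ T ∧ (fMat i p.1).mulVec p.2 = 0} := by
    ext g
    constructor
    · rintro ⟨f', hf', hQ⟩
      obtain ⟨w, hw⟩ := hQ.exists_eq_extRep
      have hker : (fMat i f').mulVec w = 0 := extRep_commutes_iff.1 (hw ▸ g.2)
      exact ⟨(f', w), ⟨hf', hker⟩, Subtype.ext ((extEC_val hker).trans hw.symm)⟩
    · rintro ⟨⟨f', w⟩, ⟨hf', hker⟩, rfl⟩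
      refine ⟨f', hf', ?_⟩
      have := isQuot_extRep (i := i) f'.1 w
      rw [← extEC_val hker] at this
      exact this
  rw [h2]
  refine h1.image _ fun a ha => regEC_comp_mem (fun j l τ s t => ?_) ha
  refine ratOn_congr (le_ratOn (extRep_entry_mem (φ := Prod.fst) (w := Prod.snd)
    (A := polyExt (regEC k K b) (Σ j : in1 i, Fin (b j)))
    (fun a ha => fst_mem_polyExt ha) (fun t => coord_mem_polyExt t) τ s t)) fun p hp => ?_
  exact congrArg (fun g : Rep K (b + simpleDim i) => LinearMap.toMatrix' (g τ) s t)
    (extEC_val hp.2)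

/-- Regular functions on the quotients lift to regular functions. -/
theorem exists_comp_quot_mem {u : EC k K b → K} (hu : u ∈ regEC k K b) :
    ∃ v ∈ regEC k K (b + simpleDim i), ∀ (f : EC k K (b + simpleDim i)) (f' : EC k K b),
      IsQuot f.1 f'.1 → v f = u f' := by
  induction hu using Algebra.adjoin_induction with
  | mem g hg =>
    obtain ⟨⟨⟨j, l, τ⟩, s, t⟩, rfl⟩ := hg
    exact ⟨_, matReg_toMatrix τ (Fin.castAdd (simpleDim i l) s) (Fin.castAdd (simpleDim i j) t),
      fun f f' h => h.toMatrix_apply τ s t⟩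
  | algebraMap c => exact ⟨_, Subalgebra.algebraMap_mem _ c, fun _ _ _ => rfl⟩
  | add g g' _ _ h h' =>
    obtain ⟨v, hv, hvg⟩ := h
    obtain ⟨v', hv', hvg'⟩ := h'
    exact ⟨v + v', Subalgebra.add_mem _ hv hv', fun f f' hQ => by
      rw [Pi.add_apply, Pi.add_apply, hvg f f' hQ, hvg' f f' hQ]⟩
  | mul g g' _ _ h h' =>
    obtain ⟨v, hv, hvg⟩ := h
    obtain ⟨v', hv', hvg'⟩ := h'
    exact ⟨v * v', Subalgebra.mul_mem _ hv hv', fun f f' hQ => by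
      rw [Pi.mul_apply, Pi.mul_apply, hvg f f' hQ, hvg' f f' hQ]⟩

/-- The points that have a standard quotient. -/
def hasQuot (i : Vertex m) (T : Set (EC k K (b + simpleDim i))) : Set (EC k K (b + simpleDim i)) :=
  {f ∈ T | ∃ f', IsQuot f.1 f'}

/-- The standard quotient is unique and its matrices are submatrices of those of `f`, so it is a
regular map. -/
theorem isPreirr_stdQuots {T : Set (EC k K (b + simpleDim i))}
    (hT : IsPreirr (regEC k K (b + simpleDim i)) (hasQuot i T)) :
    IsPreirr (regEC k K b) (stdQuots i T) := by
  classical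
  -- A point `f₀` is needed as default value to make the quotient a total map.
  rcases (stdQuots i T).eq_empty_or_nonempty with h0 | ⟨f₀, -⟩
  · rw [h0]
    rintro a - c - ⟨x, hx, -⟩
    exact hx.elim
  have key : ∀ f : EC k K (b + simpleDim i), ∃ f' : EC k K b,
      (∃ f'', IsQuot f.1 f'') → IsQuot f.1 f'.1 := by
    intro f
    by_cases h : ∃ f'', IsQuot f.1 f''
    · exact ⟨⟨h.choose, h.choose_spec.commutes f.2⟩, fun _ => h.choose_spec⟩
    · exact ⟨f₀, fun h' => (h h').elim⟩
  choose q hq using key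
  have h1 : stdQuots i T = q '' hasQuot i T := by
    ext f'
    constructor
    · rintro ⟨f, hf, hQ⟩
      exact ⟨f, ⟨hf, f'.1, hQ⟩, Subtype.ext ((hq f ⟨f'.1, hQ⟩).unique hQ)⟩
    · rintro ⟨f, ⟨hf, h⟩, rfl⟩
      exact ⟨f, hf, hq f h⟩
  rw [h1]
  refine hT.image q fun a ha => regEC_comp_mem (fun j l τ s t => ?_) ha
  refine ratOn_congr (le_ratOn (matReg_toMatrix (k := k) τ (Fin.castAdd (simpleDim i l) s)
    (Fin.castAdd (simpleDim i j) t))) fun f hf => ?_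
  exact ((hq f hf.2).toMatrix_apply τ s t).symm

/-- Having a standard quotient is a closed condition, so irreducibility is not inherited from `T`
directly. Instead, choose a point of `T`, a vector in its kernel at `i` and an invertible matrix
with that vector as last column; the new basis makes the vector standard. -/
theorem isPreirr_hasQuot [Infinite K] {T : Set (EC k K (b + simpleDim i))}
    (hT : IsPreirr (regEC k K (b + simpleDim i)) T)
    (hstab : ∀ f ∈ T, ∀ h : ∀ j, Matrix (Fin ((b + simpleDim i) j)) (Fin ((b + simpleDim i) j)) K,
      (∀ j, (h j).det ≠ 0) → conjEC h f ∈ T)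
    (hc : ∀ f ∈ T, ∀ g ∈ T, epsStarPt i f = epsStarPt i g) :
    IsPreirr (regEC k K (b + simpleDim i)) (hasQuot i T) := by
  have h1 := hT.kernels (matReg_epsMat i) fun f hf g hg => rank_eq_of_finrank_ker_eq
    (by rw [← epsStarPt_eq, ← epsStarPt_eq]; exact hc f hf g hg)
  let n := (b + simpleDim i) i
  -- Overwriting the last column of a free matrix keeps the parameter space an open subset of a
  -- product with affine space.
  let C : (EC k K (b + simpleDim i) × (Fin n → K)) × (Fin n × Fin n → K) →
      Matrix (Fin n) (Fin n) K :=
    fun p => Matrix.updateCol (Matrix.of fun s t => p.2 (s, t)) (lastIdx b i) p.1.2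
  let H : (EC k K (b + simpleDim i) × (Fin n → K)) × (Fin n × Fin n → K) →
      ∀ j, Matrix (Fin ((b + simpleDim i) j)) (Fin ((b + simpleDim i) j)) K :=
    fun p => Function.update (fun _ => 1) i (C p)
  let A := polyExt (polyExt (regEC k K (b + simpleDim i)) (Fin n)) (Fin n × Fin n)
  have hCreg : MatReg A C := by
    intro s t
    by_cases ht : t = lastIdx b i
    · have : (fun p => C p s t) = fun p => p.1.2 s := by
        funext p
        simp only [C, ht, Matrix.updateCol_self]
      rw [this]
      exact fst_mem_polyExt (coord_mem_polyExt s)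
    · have : (fun p => C p s t) = fun p => p.2 (s, t) := by
        funext p
        simp only [C, Matrix.updateCol_ne ht, Matrix.of_apply]
      rw [this]
      exact coord_mem_polyExt (s, t)
  have hHi : ∀ p, H p i = C p := fun p => Function.update_self _ _ _
  have hHne : ∀ p j, j ≠ i → H p j = 1 := fun p j hj => Function.update_of_ne hj _ _
  have hHreg : ∀ j, MatReg A fun p => H p j := by
    intro j
    by_cases hj : j = i
    · subst hj
      simp only [hHi]
      exact hCreg
    · simp only [hHne _ j hj]
      intro s t
      simp only [Matrix.one_apply]
      exact const_mem_of_zero_one _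
  have hHdet : ∀ p, (C p).det ≠ 0 → ∀ j, (H p j).det ≠ 0 := by
    intro p hp j
    by_cases hj : j = i
    · subst hj
      rw [hHi]
      exact hp
    · rw [hHne p j hj, Matrix.det_one]
      exact one_ne_zero
  have hClast : ∀ p, (C p).mulVec (lastVec K b i) = p.1.2 := by
    intro p
    rw [lastVec, Matrix.mulVec_single_one]
    funext s
    simp [C]
  have h2 : IsPreirr A {p | (p.1.1 ∈ T ∧ (epsMat i p.1.1).mulVec p.1.2 = 0) ∧ (C p).det ≠ 0} :=
    (h1.prod (τ := Fin n × Fin n)).of_locally_open (fun p hp => hp.1) fun p hp =>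
      ⟨fun p => (C p).det, hCreg.det, hp.2, fun q hq hq0 => ⟨hq, hq0⟩⟩
  have h3 : hasQuot i T = (fun p => conjEC (H p) p.1.1) ''
      {p | (p.1.1 ∈ T ∧ (epsMat i p.1.1).mulVec p.1.2 = 0) ∧ (C p).det ≠ 0} := by
    ext f
    constructor
    · rintro ⟨hf, hQ⟩
      -- A point that already has a standard quotient is reached with the identity matrix, whose
      -- last column is the last basis vector.
      let p : (EC k K (b + simpleDim i) × (Fin n → K)) × (Fin n × Fin n → K) :=
        ((f, lastVec K b i), fun e => (1 : Matrix (Fin n) (Fin n) K) e.1 e.2)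
      have hC : C p = 1 := by
        ext s t
        by_cases ht : t = lastIdx b i
        · simp only [C, ht, Matrix.updateCol_self, p, lastVec, Matrix.one_apply, Pi.single_apply]
        · simp only [C, Matrix.updateCol_ne ht, p, Matrix.of_apply]
      have hH : H p = fun _ => 1 := by
        funext j
        by_cases hj : j = i
        · subst hj
          rw [hHi, hC]
        · exact hHne p j hj
      refine ⟨p, ⟨⟨hf, epsMat_mulVec_lastVec_eq_zero_iff.2 hQ⟩, ?_⟩, ?_⟩
      · rw [hC, Matrix.det_one]
        exact one_ne_zero
      · change conjEC (H p) f = f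
        rw [hH, conjEC_one]
    · rintro ⟨p, ⟨⟨hp, hker⟩, hdet⟩, rfl⟩
      have hh := hHdet p hdet
      refine ⟨hstab _ hp _ hh, ?_⟩
      rw [← epsMat_mulVec_lastVec_eq_zero_iff, epsMat_mulVec_eq_zero_iff]
      intro j τ
      change (conjEC (H p) p.1.1).1 τ (lastVec K b i) = 0
      rw [conjEC_val hh, conj_apply_eq_zero_iff hh, hHi, hClast]
      exact epsMat_mulVec_eq_zero_iff.1 hker j τ
  rw [h3]
  exact h2.image _ fun a ha => conjEC_comp_mem (A := A) (φ := fun p => p.1.1) (H := H)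
    (fun a ha => fst_mem_polyExt (fst_mem_polyExt ha)) hHreg (fun p hp => hHdet p hp.2) ha

/-! ## The operators are partial inverses of each other -/

variable {Λ : Set (EC k K b)} {Λ' : Set (EC k K (b + simpleDim i))}

theorem locus3_nonempty (hΛ : Λ ∈ irreducibleComponents (EC k K b)) : (locus3 i Λ).Nonempty :=
  minLocus_nonempty _ (nonempty_of_mem_irreducibleComponents hΛ)

theorem locus4_nonempty (hΛ : Λ ∈ irreducibleComponents (EC k K b)) : (locus4 i Λ).Nonempty :=
  minLocus_nonempty _ (nonempty_of_mem_irreducibleComponents hΛ)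

theorem locus3_inter_locus4_nonempty (hΛ : Λ ∈ irreducibleComponents (EC k K b)) :
    (locus3 i Λ ∩ locus4 i Λ).Nonempty :=
  ((isUSC_finrank_extStar i).isRelOpen_minLocus Λ).inter_nonempty
    ((isUSC_epsStarPt i).isRelOpen_minLocus Λ) (isPreirr_of_mem_irreducibleComponents hΛ)
    (locus3_nonempty hΛ) (locus4_nonempty hΛ)

/-- The minimum of `ε*_i` on the closure of `ϖ₄(ϖ₃⁻¹(Λ³))`. -/
theorem sInf_epsStarPt_closure_stdExt (hΛ : Λ ∈ irreducibleComponents (EC k K b)) :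
    sInf (epsStarPt i '' closure (varpi4 k '' ((varpi3 k :
      ExtPoint K (simpleDim i) b (b + simpleDim i) → EC k K b) ⁻¹' locus3 i Λ))) =
      sInf (epsStarPt i '' Λ) + 1 := by
  obtain ⟨f', h3, h4⟩ := locus3_inter_locus4_nonempty (i := i) hΛ
  obtain ⟨f, hf⟩ := exists_isQuot_lift i f'
  rw [sInf_image_eq_of_mem_minLocus h4]
  refine (isUSC_epsStarPt i).sInf_image_closure (x := f) ?_ ?_ hf.epsStarPt_eq
  · rintro _ ⟨x, hx, rfl⟩
    rw [x.epsStarPt_varpi4]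
    exact Nat.succ_le_succ (h4.2 _ hx.1)
  · rw [varpi4_image_eq]
    exact subset_orbits _ ⟨f', h3, hf⟩

variable [Infinite K]

theorem isPreirr_hasQuot_locus4 (hΛ' : Λ' ∈ irreducibleComponents (EC k K (b + simpleDim i))) :
    IsPreirr (regEC k K (b + simpleDim i)) (hasQuot i (locus4 i Λ')) :=
  isPreirr_hasQuot
    (((isUSC_epsStarPt i).isRelOpen_minLocus Λ').isPreirr
      (isPreirr_of_mem_irreducibleComponents hΛ'))
    (fun _ hf _ hh => conjEC_mem_locus4 hΛ' hf hh)
    fun _ hf _ hg => ((mem_minLocus_iff_eq hg).1 hf).2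

/-- A point of `Λ` generic for both minima lifts to `Λ'`, and the lift lies in `Λ⁴` of `Λ'` because
the minimum of `ε*_i` rises by exactly one. Such points are dense in `Λ`. -/
theorem closure_stdQuots_eq (hΛ : Λ ∈ irreducibleComponents (EC k K b))
    (hΛ' : Λ' ∈ irreducibleComponents (EC k K (b + simpleDim i)))
    (h : closure (varpi4 k '' ((varpi3 k :
      ExtPoint K (simpleDim i) b (b + simpleDim i) → EC k K b) ⁻¹' locus3 i Λ)) = Λ') :
    closure (varpi3 k '' ((varpi4 k : ExtPoint K (simpleDim i) b (b + simpleDim i) →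
      EC k K (b + simpleDim i)) ⁻¹' locus4 i Λ')) = Λ := by
  have heps := sInf_epsStarPt_closure_stdExt (i := i) hΛ
  rw [h] at heps
  rw [varpi3_image_eq fun _ hf _ hh => conjEC_mem_locus4 hΛ' hf hh]
  refine closure_eq_of_subset_closure hΛ (isPreirr_stdQuots (isPreirr_hasQuot_locus4 hΛ')) ?_
  have hopen : IsRelOpen (locus3 i Λ ∩ locus4 i Λ) Λ :=
    ((isUSC_finrank_extStar i).isRelOpen_minLocus Λ).inter
      ((isUSC_epsStarPt i).isRelOpen_minLocus Λ)
  refine (hopen.subset_closure (isPreirr_of_mem_irreducibleComponents hΛ)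
    (locus3_inter_locus4_nonempty hΛ)).trans (closure_mono ?_)
  rintro f' ⟨h3, h4⟩
  obtain ⟨f, hf⟩ := exists_isQuot_lift i f'
  have hfΛ : f ∈ Λ' := by
    rw [← h, varpi4_image_eq]
    exact subset_closure (subset_orbits _ ⟨f', h3, hf⟩)
  refine ⟨f, ⟨hfΛ, fun g hg => ?_⟩, hf⟩
  rw [hf.epsStarPt_eq, ← sInf_image_eq_of_mem_minLocus h4, ← heps]
  exact Nat.sInf_le ⟨g, hg, rfl⟩

/-- Among the points of `Λ'⁴` with a standard quotient, those whose quotient lies in `Λ³` form a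
nonempty open subset `W`. Positivity of `ε*_i` brings every point of `Λ'⁴` into such a position by a
change of bases, so the orbits of `W` are dense in `Λ'`. -/
theorem closure_stdExt_eq (hΛ : Λ ∈ irreducibleComponents (EC k K b))
    (hΛ' : Λ' ∈ irreducibleComponents (EC k K (b + simpleDim i)))
    (hpos : 0 < sInf (epsStarPt i '' Λ'))
    (h : closure (varpi3 k '' ((varpi4 k : ExtPoint K (simpleDim i) b (b + simpleDim i) →
      EC k K (b + simpleDim i)) ⁻¹' locus4 i Λ')) = Λ) :
    closure (varpi4 k '' ((varpi3 k :
      ExtPoint K (simpleDim i) b (b + simpleDim i) → EC k K b) ⁻¹' locus3 i Λ)) = Λ' := by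
  rw [varpi3_image_eq fun _ hf _ hh => conjEC_mem_locus4 hΛ' hf hh] at h
  have h3open := (isUSC_finrank_extStar i).isRelOpen_minLocus Λ
  have hΛirr := isPreirr_of_mem_irreducibleComponents hΛ
  rw [varpi4_image_eq]
  refine closure_eq_of_subset_closure hΛ' (isPreirr_stdExt (h3open.isPreirr hΛirr)
    fun _ hf _ hg => ((mem_minLocus_iff_eq hg).1 hf).2).orbits ?_
  have hZ := isPreirr_hasQuot_locus4 hΛ'
  let W : Set (EC k K (b + simpleDim i)) := hasQuot i (locus4 i Λ') ∩ stdExt i (locus3 i Λ)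
  have hmemΛ : ∀ f ∈ locus4 i Λ', ∀ f' : EC k K b, IsQuot f.1 f'.1 → f' ∈ Λ := by
    intro f hf f' hQ
    rw [← h]
    exact subset_closure ⟨f, hf, hQ⟩
  have hW : IsRelOpen W (hasQuot i (locus4 i Λ')) := by
    refine ⟨fun f hf => hf.1, ?_⟩
    rintro f ⟨hf, f', hf', hQ⟩
    obtain ⟨u, hu, huf, huΛ⟩ := h3open.2 f' hf'
    obtain ⟨v, hv, hvu⟩ := exists_comp_quot_mem (i := i) hu
    refine ⟨v, hv, by rwa [hvu _ _ hQ], fun g hg hvg => ⟨hg, ?_⟩⟩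
    obtain ⟨g', hg'⟩ := hg.2
    let g'' : EC k K b := ⟨g', hg'.commutes g.2⟩
    exact ⟨g'', huΛ g'' (hmemΛ g hg.1 g'' hg') (by rwa [← hvu g g'' hg']), hg'⟩
  have hW0 : W.Nonempty := by
    obtain ⟨f', hf'⟩ := locus3_nonempty (i := i) hΛ
    obtain ⟨u, hu, huf, huΛ⟩ := h3open.2 f' hf'
    have hcl : f' ∈ closure (stdQuots i (locus4 i Λ')) := by
      rw [h]
      exact hf'.1
    rw [mem_closure_iff_regEC] at hcl
    -- The quotients are dense in `Λ`, so one of them meets the open neighbourhood of `f'` inside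
    -- `Λ³`.
    have := mt (hcl u hu) huf
    push Not at this
    obtain ⟨g', ⟨g, hg, hQ⟩, hne⟩ := this
    exact ⟨g, ⟨hg, g'.1, hQ⟩, g', huΛ g' (hmemΛ g hg g' hQ) hne, hQ⟩
  have h4 : locus4 i Λ' ⊆ orbits (hasQuot i (locus4 i Λ')) := by
    intro f hf
    have hpos' : 0 < epsStarPt i f := by
      rwa [← sInf_image_eq_of_mem_minLocus hf]
    obtain ⟨h, hh, f', hQ⟩ := exists_conjEC_isQuot hpos'
    refine ⟨conjEC h f, ⟨conjEC_mem_locus4 hΛ' hf hh, f', ?_⟩, _, det_inv_ne_zero hh,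
      conjEC_conjEC_inv hh f⟩
    rw [conjEC_val hh]
    exact hQ
  have h5 : orbits W ⊆ orbits (stdExt i (locus3 i Λ)) := by
    rintro _ ⟨f, hf, h, hh, rfl⟩
    exact ⟨f, hf.2, h, hh, rfl⟩
  have h6 : locus4 i Λ' ⊆ closure (orbits (stdExt i (locus3 i Λ))) :=
    (h4.trans (orbits_subset_closure hZ hW hW0)).trans (closure_mono h5)
  exact (((isUSC_epsStarPt i).isRelOpen_minLocus Λ').subset_closure
    (isPreirr_of_mem_irreducibleComponents hΛ') (locus4_nonempty hΛ')).trans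
    (closure_minimal h6 isClosed_closure)

end Correspondence

/-! ## The crystal axioms -/

section CrystalAxioms

variable {d : ℕ} {m : Fin d → ℕ}

theorem isGCM_cartan (m : Fin d → ℕ) : IsGCM (cartan m) where
  diag i := if_pos rfl
  nonpos i j h := by
    rw [cartan, if_neg h]
    omega
  symm_ne_zero i j h := by
    rw [cartan, cartan, if_neg h, if_neg h.symm]
    omega

variable {𝔥 : Type*} [AddCommGroup 𝔥] [Module ℂ 𝔥]

/-! ### The integral pairing of weights with simple coroots -/

section Pairing

variable {I : Type*} [Fintype I] {A : Matrix I I ℤ} {R : Realization A 𝔥} (L : WeightLattice R)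

theorem WeightLattice.pairing_add (i : I) (v w : L.P) :
    L.pairing i (v + w) = L.pairing i v + L.pairing i w := by
  have h : ((L.pairing i (v + w) : ℤ) : ℂ) = ((L.pairing i v + L.pairing i w : ℤ) : ℂ) := by
    rw [Int.cast_add, ← L.pairing_spec, ← L.pairing_spec, ← L.pairing_spec]
    rfl
  exact_mod_cast h

theorem WeightLattice.pairing_simpleRoot (i j : I) : L.pairing i (L.simpleRoot j) = A i j := by
  have h := L.pairing_spec i (L.simpleRoot j)
  rw [WeightLattice.simpleRoot, R.root_coroot] at h
  exact_mod_cast h.symm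

end Pairing

variable {k K : Type*} [Field k] [Field K] [Algebra k K]
  {R : Realization (cartan m) 𝔥} (L : WeightLattice R)

theorem weight_add_simpleRoot {i : Vertex m} {b b' : BC k K m} (h : b'.1 = b.1 + simpleDim i) :
    weight L b' + L.simpleRoot i = weight L b := by
  have h1 : ∑ j : Vertex m, (b'.1 j : ℤ) • L.simpleRoot j =
      ∑ j : Vertex m, (b.1 j : ℤ) • L.simpleRoot j + L.simpleRoot i := by
    have h2 : ∀ j : Vertex m, (b'.1 j : ℤ) • L.simpleRoot j = (b.1 j : ℤ) • L.simpleRoot j +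
        if j = i then L.simpleRoot j else 0 := by
      intro j
      rw [h, Pi.add_apply, simpleDim, Pi.single_apply]
      split_ifs <;> simp [add_smul]
    rw [Finset.sum_congr rfl fun j _ => h2 j, Finset.sum_add_distrib]
    simp
  rw [weight, weight, h1]
  abel

variable {ν μ : Vertex m → ℕ} {i : Vertex m} {Λ : Set (EC k K μ)} {Λ' : Set (EC k K ν)}
  {hΛ : Λ ∈ irreducibleComponents (EC k K μ)} {hΛ' : Λ' ∈ irreducibleComponents (EC k K ν)}

/-- Keeping `μ` and `ν` as separate variables joined by an equation avoids transporting components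
between equal dimension vectors. -/
theorem eStar_eq_some_iff (h : ν - simpleDim i = μ) :
    eStar i (⟨ν, Λ', hΛ'⟩ : BC k K m) = some ⟨μ, Λ, hΛ⟩ ↔
      0 < sInf (epsStarPt i '' Λ') ∧ closure (varpi3 k '' ((varpi4 k :
        ExtPoint K (simpleDim i) μ ν → EC k K ν) ⁻¹' locus4 i Λ')) = Λ := by
  subst h
  rw [eStar]
  constructor
  · intro h
    split_ifs at h with h0
    simp only [Option.some.injEq, Sigma.mk.injEq, heq_eq_eq, Subtype.mk.injEq, true_and] at h
    exact ⟨h0.1, h⟩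
  · rintro ⟨h0, rfl⟩
    exact dif_pos ⟨h0, hΛ⟩

theorem fStar_eq_some_iff (h : μ + simpleDim i = ν) :
    fStar i (⟨μ, Λ, hΛ⟩ : BC k K m) = some ⟨ν, Λ', hΛ'⟩ ↔
      closure (varpi4 k '' ((varpi3 k :
        ExtPoint K (simpleDim i) μ ν → EC k K μ) ⁻¹' locus3 i Λ)) = Λ' := by
  subst h
  rw [fStar]
  constructor
  · intro h
    split_ifs at h with h0
    simp only [Option.some.injEq, Sigma.mk.injEq, heq_eq_eq, Subtype.mk.injEq, true_and] at h
    exact h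
  · rintro rfl
    exact dif_pos hΛ'

theorem fst_of_fStar_eq_some {b b' : BC k K m} (h : fStar i b = some b') :
    b'.1 = b.1 + simpleDim i := by
  rw [fStar] at h
  split_ifs at h
  rw [← Option.some.inj h]

theorem fst_of_eStar_eq_some {b b' : BC k K m} (h : eStar i b' = some b) :
    b'.1 = b.1 + simpleDim i := by
  rw [eStar] at h
  split_ifs at h with h0
  rw [← Option.some.inj h]
  obtain ⟨f, hf⟩ := minLocus_nonempty (epsStarPt i) (nonempty_of_mem_irreducibleComponents b'.2.2)
  have h1 : 0 < epsStarPt i f := by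
    rw [← sInf_image_eq_of_mem_minLocus hf]
    exact h0.1
  -- The kernel lies in `K^{ν_i}`, so positivity of `ε*_i` gives `ν_i > 0` and the truncated
  -- subtraction of `δ_i` is a true one.
  have h2 : epsStarPt i f ≤ b'.1 i := by
    have := Submodule.finrank_le (LinearMap.ker
      (LinearMap.pi (fun τ : (Σ j : Vertex m, (i ⟶ j)) => f.1 τ.2)))
    rwa [Module.finrank_fin_fun] at this
  have h3 : simpleDim i ≤ b'.1 := by
    intro j
    by_cases hj : j = i
    · subst hj
      rw [simpleDim, Pi.single_eq_same]
      exact Nat.succ_le_of_lt (h1.trans_le h2)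
    · rw [simpleDim, Pi.single_eq_of_ne hj]
      exact Nat.zero_le _
  exact (tsub_add_cancel_of_le h3).symm

theorem epsStarNat_of_fStar_eq_some {b b' : BC k K m} (h : fStar i b = some b') :
    epsStarNat i b' = epsStarNat i b + 1 := by
  have h0 := fst_of_fStar_eq_some h
  obtain ⟨μ, Λ, hΛ⟩ := b
  obtain ⟨ν, Λ', hΛ'⟩ := b'
  change ν = μ + simpleDim i at h0
  subst h0
  rw [fStar_eq_some_iff rfl] at h
  change sInf (epsStarPt i '' Λ') = sInf (epsStarPt i '' Λ) + 1
  rw [← h, sInf_epsStarPt_closure_stdExt hΛ]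

variable [Infinite K]

theorem eStar_iff_fStar (i : Vertex m) (b b' : BC k K m) :
    eStar i b' = some b ↔ fStar i b = some b' := by
  by_cases h : b'.1 = b.1 + simpleDim i
  · obtain ⟨μ, Λ, hΛ⟩ := b
    obtain ⟨ν, Λ', hΛ'⟩ := b'
    change ν = μ + simpleDim i at h
    subst h
    rw [eStar_eq_some_iff (add_tsub_cancel_right _ _), fStar_eq_some_iff rfl]
    constructor
    · rintro ⟨hpos, h⟩
      exact closure_stdExt_eq hΛ hΛ' hpos h
    · intro h
      refine ⟨?_, closure_stdQuots_eq hΛ hΛ' h⟩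
      rw [← h, sInf_epsStarPt_closure_stdExt hΛ]
      exact Nat.succ_pos _
  · exact ⟨fun he => (h (fst_of_eStar_eq_some he)).elim,
      fun hf => (h (fst_of_fStar_eq_some hf)).elim⟩

theorem isCrystal_star : IsCrystal L (B := BC k K m) (weight L) epsStar (phiStar L) eStar fStar := by
  -- Both directions of the numerical change are recorded, so that the axiom for `eStar` follows
  -- from that for `fStar` by axiom 4.
  have hf : ∀ i (b b' : BC k K m), fStar i b = some b' →
      (weight L b' = weight L b - L.simpleRoot i ∧
      epsStar i b' = epsStar i b + ((1 : ℤ) : WithBot ℤ) ∧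
      phiStar L i b' = phiStar L i b + ((-1 : ℤ) : WithBot ℤ)) ∧
      (weight L b = weight L b' + L.simpleRoot i ∧
      epsStar i b = epsStar i b' + ((-1 : ℤ) : WithBot ℤ) ∧
      phiStar L i b = phiStar L i b' + ((1 : ℤ) : WithBot ℤ)) := by
    intro i b b' h
    have hw := weight_add_simpleRoot L (fst_of_fStar_eq_some h)
    have he := epsStarNat_of_fStar_eq_some h
    -- The pairing drops by `A i i = 2` while `ε*_i` rises by one, so `φ*_i` drops by one.
    have hp : L.pairing i (weight L b) = L.pairing i (weight L b') + 2 := by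
      rw [← hw, L.pairing_add, L.pairing_simpleRoot, (isGCM_cartan m).diag]
    refine ⟨⟨eq_sub_of_add_eq hw, ?_, ?_⟩, hw.symm, ?_, ?_⟩ <;>
    · simp only [phiStar, epsStar, he, hp, ← WithBot.coe_add]
      refine congrArg WithBot.some ?_
      omega
  refine ⟨isGCM_cartan m, fun _ _ => rfl, fun i b b' h => ?_, fun i b b' h => (hf i b b' h).1,
    eStar_iff_fStar, fun i b h => ?_⟩
  · exact (hf i b' b ((eStar_iff_fStar i b' b).1 h)).2
  · exact absurd h WithBot.coe_ne_bot

end CrystalAxioms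

end PersistenceCrystal

end

theorem theorem3p14 {k K : Type*} [Field k] [Field K] [Algebra k K] [Infinite K]
    {d : ℕ} (m : Fin d → ℕ) {𝔥 : Type*} [AddCommGroup 𝔥] [Module ℂ 𝔥]
    (R : PersistenceCrystal.Realization (PersistenceCrystal.cartan m) 𝔥)
    (L : PersistenceCrystal.WeightLattice R) :
    PersistenceCrystal.IsCrystal L (B := PersistenceCrystal.BC k K m)
      (PersistenceCrystal.weight L) PersistenceCrystal.epsStar (PersistenceCrystal.phiStar L)
      PersistenceCrystal.eStar PersistenceCrystal.fStar :=
  PersistenceCrystal.isCrystal_star L
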